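/- Consider the power functions $t^\alpha$ on $(0,\infty)$, where $\alpha\in\mathbb{R}$. Definitions. For Hermitian matrices or bounded self-adjoint operators, $A\ge B$ means that $A-B$ is positive semidefinite, and $f(A)$ is given by the functional calculus. A continuous function $f:(0,\infty)\to\mathbb{R}$ is $n$-monotone if $A\ge B$ implies $f(A)\ge f(B)$ for all Hermitian $A,B\in M_n(\mathbb{C})$ with spectra in $(0,\infty)$. It is $n$-convex if $f(\lambda A+(1-\lambda)B)\le\lambda f(A)+(1-\lambda)f(B)$ for all such $A,B$ and all $\lambda\in(0,1)$. It is operator monotone (resp. operator convex) if the same condition holds for all bounded self-adjoint operators $A,B$ with spectra in $(0,\infty)$ on an infinite-dimensional separable complex Hilbert space. A Hermitian matrix $A\in M_n(\mathbb{C})$ is conditionally positive definite (c.p.d.) if $\langle x,Ax\rangle\ge0$ for all $x\in\mathbb{C}^n$ with $\sum_i x_i=0$, and conditionally negative definite (c.n.d.) if $-A$ is c.p.d. For a $C^1$ function $f$ on $(0,\infty)$ and $t_1,\dots,t_n\in(0,\infty)$, not necessarily distinct, the Loewner matrix $L_f(t_1,\dots,t_n)$ is the $n\times n$ matrix whose $(i,j)$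 entry is $\frac{f(t_i)-f(t_j)}{t_i-t_j}$ if $t_i\ne t_j$ and $f'(t_i)$ if $t_i=t_j$. Then: (1) $t^\alpha$ is $2$-monotone if and only if $0\le\alpha\le1$, or equivalently, $t^\alpha$ is operator monotone. Moreover, $-t^\alpha$ is $2$-monotone if and only if $-1\le\alpha\le0$. (2) $t^\alpha$ is $2$-convex if and only if either $-1\le\alpha\le0$ or $1\le\alpha\le2$, or equivalently, $t^\alpha$ is operator convex. (3) $L_{t^\alpha}(t_1,t_2)$ is c.p.d. for all $t_1,t_2\in(0,\infty)$ if and only if either $0\le\alpha\le1$ or $\alpha\ge2$. (4) $L_{t^\alpha}(t_1,t_2)$ is c.n.d. for all $t_1,t_2\in(0,\infty)$ if and only if either $\alpha\le0$ or $1\le\alpha\le2$. (5) $L_{t^\alpha}(t_1,t_2,t_3)$ is c.p.d. for all $t_1,t_2,t_3\in(0,\infty)$ if and only if either $0\le\alpha\le1$ or $2\le\alpha\le3$. (6) $L_{t^\alpha}(t_1,t_2,t_3)$ is c.n.d. for all $t_1,t_2,t_3\in(0,\infty)$ if and only if either $-1\le\alpha\le0$ or $1\le\alpha\le2$. -/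

import Mathlib

namespace LoewnerPower

section Order

open scoped MatrixOrder

/-- `f` is matrix monotone of order `n` on the interval `J`: for Hermitian complex `n × n` matrices
`A`, `B` with spectra in `J`, `B ≤ A` implies `f(B) ≤ f(A)`, where `≤` is the Loewner order
(the difference is positive semidefinite) and `f(A)` is the functional calculus. -/
def MatrixMonotone (n : ℕ) (J : Set ℝ) (f : ℝ → ℝ) : Prop :=
  ∀ A B : Matrix (Fin n) (Fin n) ℂ, A.IsHermitian → B.IsHermitian →
    spectrum ℝ A ⊆ J → spectrum ℝ B ⊆ J → B ≤ A → cfc f B ≤ cfc f A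

/-- `f` is matrix convex of order `n` on the interval `J`: for Hermitian complex `n × n` matrices
`A`, `B` with spectra in `J` and `c ∈ (0, 1)`,
`f(c A + (1 - c) B) ≤ c f(A) + (1 - c) f(B)` in the Loewner order. -/
def MatrixConvex (n : ℕ) (J : Set ℝ) (f : ℝ → ℝ) : Prop :=
  ∀ A B : Matrix (Fin n) (Fin n) ℂ, A.IsHermitian → B.IsHermitian →
    spectrum ℝ A ⊆ J → spectrum ℝ B ⊆ J → ∀ c : ℝ, 0 < c → c < 1 →
      cfc f (c • A + (1 - c) • B) ≤ c • cfc f A + (1 - c) • cfc f B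

end Order

section Operator

variable (H : Type*) [NormedAddCommGroup H] [InnerProductSpace ℂ H] [CompleteSpace H]

/-- `f` is operator monotone on the interval `J`, for bounded self-adjoint operators on the complex
Hilbert space `H` with spectra in `J`; here `≤` is the Loewner order (the difference is a positive
operator) and `f(A)` is the continuous functional calculus. -/
def OperatorMonotone (J : Set ℝ) (f : ℝ → ℝ) : Prop :=
  ∀ A B : H →L[ℂ] H, IsSelfAdjoint A → IsSelfAdjoint B →
    spectrum ℝ A ⊆ J → spectrum ℝ B ⊆ J → B ≤ A → cfc f B ≤ cfc f A

/-- `f` is operator convex on the interval `J`, for bounded self-adjoint operators on the complex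
Hilbert space `H` with spectra in `J`. -/
def OperatorConvex (J : Set ℝ) (f : ℝ → ℝ) : Prop :=
  ∀ A B : H →L[ℂ] H, IsSelfAdjoint A → IsSelfAdjoint B →
    spectrum ℝ A ⊆ J → spectrum ℝ B ⊆ J → ∀ c : ℝ, 0 < c → c < 1 →
      cfc f (c • A + (1 - c) • B) ≤ c • cfc f A + (1 - c) • cfc f B

end Operator

/-- A complex matrix is conditionally positive definite if it is Hermitian and `⟨x, A x⟩ ≥ 0` for
all `x ∈ ℂⁿ` with `∑ xᵢ = 0`. (The form is real because `A` is Hermitian.) -/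
def IsCPD {n : ℕ} (A : Matrix (Fin n) (Fin n) ℂ) : Prop :=
  A.IsHermitian ∧
    ∀ x : Fin n → ℂ, ∑ i, x i = 0 → 0 ≤ (dotProduct (star x) (A.mulVec x)).re

/-- A matrix `A` is conditionally negative definite if `-A` is conditionally positive definite. -/
def IsCND {n : ℕ} (A : Matrix (Fin n) (Fin n) ℂ) : Prop :=
  IsCPD (-A)

/-- The Loewner matrix of `f` at the (not necessarily distinct) points `t₁, …, tₙ`: its
`(i, j)` entry is the divided difference, `(f tᵢ - f tⱼ) / (tᵢ - tⱼ)` if `tᵢ ≠ tⱼ` and `f' tᵢ` if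
`tᵢ = tⱼ`. -/
noncomputable def loewnerMatrix {n : ℕ} (f : ℝ → ℝ) (t : Fin n → ℝ) :
    Matrix (Fin n) (Fin n) ℂ :=
  Matrix.of fun i j =>
    ((if t i = t j then deriv f (t i) else (f (t i) - f (t j)) / (t i - t j) : ℝ) : ℂ)

end LoewnerPower

/-!
*Monotonicity and convexity, sufficiency.* Powers with exponent in `[0, 1]` are operator monotone
and operator concave in every C⋆-algebra. Since inversion is antitone and convex on the positive
cone, powers with exponent in `[-1, 0]` are antitone and convex. For exponents in `[1, 2]` the
integral representation by `Real.rpowIntegrand₁₂` reduces convexity to that of resolvents. An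
operator inequality on an infinite-dimensional space `H` restricts to matrices, because `M ↦ M ⊕
1`, taken along an isometry `ℂⁿ → H`, is compatible with the functional calculus and preserves and
reflects the order (`cfc_dilation`).

*Monotonicity and convexity, necessity.* Explicit real symmetric `2 × 2` matrices are used, whose
functional calculus is computed by affine interpolation on the spectrum. Scalar matrices exclude
exponents for which `t ^ p` is not even monotone or convex on the line. For the others outside the
stated ranges the inequality between the matrices contradicts Jensen's inequality `((1 + 3) / 2) ^
s < (1 ^ s + 3 ^ s) / 2`, or lets a bounded matrix entry grow without bound.

*Loewner matrices.* Conditional definiteness concerns the real form `∑ vᵢ vⱼ f[tᵢ, tⱼ]` on vectors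
with `∑ vᵢ = 0`. A power with exponent in `(m - 1, m)`, for `m = 0, 1, 2, 3`, is a superposition
over `s > 0` of the functions `t ^ m / (s + t)`, and on these vectors the Loewner form of such a
function is `(-1) ^ (m + 1) s ^ m (∑ vᵢ / (s + tᵢ)) ^ 2`. This settles the sign in every size for
exponents in `[-1, 3]` (`loewnerForm_rpow_sign`). For two points the form measures the error of
the trapezoid rule for the derivative, whose sign for exponents outside `[0, 2]` is given by
convexity of the derivative; both signs occur together only for exponents `0`, `1`, `2`, which
yields the converse. For three points, exponents above `3` and below `-1` are excluded by letting
points tend to `0` or to infinity. -/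

namespace LoewnerPower

/-! ### Powers on the positive cone of a C⋆-algebra -/

section CStar

open Set MeasureTheory

variable {A : Type*} [CStarAlgebra A] [PartialOrder A] [StarOrderedRing A]

/-- For `p ∈ [-1, 0]` the power `a ^ p` is the inverse of the monotone power `a ^ (-p)`. -/
theorem rpow_le_rpow_of_mem_Icc_neg_one_zero {p : ℝ} (hp : p ∈ Icc (-1) 0) {a b : A}
    (ha : IsStrictlyPositive a) (hab : a ≤ b) : b ^ p ≤ a ^ p := by
  have hb := ha.of_le hab
  rcases eq_or_ne p 0 with rfl | hp0
  · rw [CFC.rpow_zero a ha.nonneg, CFC.rpow_zero b hb.nonneg]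
  · have h : a ^ (-p) ≤ b ^ (-p) := CFC.rpow_le_rpow ⟨by linarith [hp.2], by linarith [hp.1]⟩ hab
    have := CStarAlgebra.ringInverse_le_ringInverse h (IsStrictlyPositive.rpow a _ ha)
    rwa [CFC.inverse_rpow a _ (neg_ne_zero.2 hp0) ha, CFC.inverse_rpow b _ (neg_ne_zero.2 hp0) hb,
      neg_neg] at this

theorem convex_isStrictlyPositive : Convex ℝ {a : A | IsStrictlyPositive a} :=
  CStarAlgebra.convexOn_ringInverse.1

/-- For `p ∈ [-1, 0]` the power `a ^ p` is the inverse of the concave power `a ^ (-p)`, and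
inversion is antitone and convex. -/
theorem convexOn_rpow_of_mem_Icc_neg_one_zero {p : ℝ} (hp : p ∈ Icc (-1) 0) :
    ConvexOn ℝ {a : A | IsStrictlyPositive a} (fun a : A => a ^ p) := by
  refine ⟨convex_isStrictlyPositive, fun a ha b hb s t hs ht hst => ?_⟩
  have hab := convex_isStrictlyPositive ha hb hs ht hst
  simp only [mem_ofPred_eq] at ha hb hab ⊢
  rcases eq_or_ne p 0 with rfl | hp0
  · rw [CFC.rpow_zero a ha.nonneg, CFC.rpow_zero b hb.nonneg, CFC.rpow_zero _ hab.nonneg,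
      ← add_smul, hst, one_smul]
  · have h := (CFC.concaveOn_rpow (A := A) (p := -p) ⟨by linarith [hp.2], by linarith [hp.1]⟩).2
      ha.nonneg hb.nonneg hs ht hst
    have ha' := IsStrictlyPositive.rpow a (-p) ha
    have hb' := IsStrictlyPositive.rpow b (-p) hb
    have h1 := CStarAlgebra.ringInverse_le_ringInverse h
      (convex_isStrictlyPositive ha' hb' hs ht hst)
    have h2 := CStarAlgebra.convexOn_ringInverse.2 ha' hb' hs ht hst
    rw [CFC.inverse_rpow _ _ (neg_ne_zero.2 hp0) hab, neg_neg] at h1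
    rw [CFC.inverse_rpow a _ (neg_ne_zero.2 hp0) ha, CFC.inverse_rpow b _ (neg_ne_zero.2 hp0) hb,
      neg_neg] at h2
    exact h1.trans h2

/-- The integrand is, up to a positive factor, the sum of an affine function and a positive
multiple of a resolvent, which is convex. -/
theorem convexOn_cfc_rpowIntegrand₁₂ (p : ℝ) {t : ℝ} (ht : 0 < t) :
    ConvexOn ℝ (Ici (0 : A)) (cfc (Real.rpowIntegrand₁₂ p t)) := by
  have h₁ : (Ici (0 : A)).EqOn (cfc (Real.rpowIntegrand₁₂ p t))
      (fun x : A => t ^ (p - 1) • (t⁻¹ • x + t • Ring.inverse (algebraMap ℝ A t + x) +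
        algebraMap ℝ A (-1))) := by
    intro x hx
    have hspec : ∀ r ∈ spectrum ℝ x, 0 ≤ r := fun r hr => spectrum_nonneg_of_nonneg hx hr
    have hne : ∀ r ∈ spectrum ℝ x, t + r ≠ 0 := fun r hr => by linarith [hspec r hr]
    have hg : ContinuousOn (fun z : ℝ => (t + z)⁻¹) (spectrum ℝ x) :=
      ContinuousOn.inv₀ (by fun_prop) hne
    have hsa : IsSelfAdjoint x := IsSelfAdjoint.of_nonneg hx
    have he : Real.rpowIntegrand₁₂ p t =
        fun z => t ^ (p - 1) * (t⁻¹ * z + t * (t + z)⁻¹ + (-1)) := by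
      ext z; simp [Real.rpowIntegrand₁₂, sub_eq_add_neg]
    have hg1 : ContinuousOn (fun z : ℝ => t * (t + z)⁻¹) (spectrum ℝ x) := by fun_prop
    rw [he, cfc_const_mul _ _ x (by fun_prop), cfc_add_const _ _ x (by fun_prop),
      cfc_add x _ _ (by fun_prop) hg1, cfc_const_mul _ _ x, cfc_const_mul _ _ x hg,
      cfc_inv _ x hne (by fun_prop), cfc_const_add _ _ x, cfc_id' ℝ x]
  refine ConvexOn.congr ?_ h₁.symm
  refine ConvexOn.smul (by positivity) (ConvexOn.add (ConvexOn.add ?_ ?_)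
    (convexOn_const _ (convex_Ici 0)))
  · exact ConvexOn.smul (by positivity) (convexOn_id (convex_Ici 0))
  · exact ConvexOn.smul ht.le (CStarAlgebra.convexOn_ringInverse_algebraMap_add ht)

/-- The endpoint `p = 1` is trivial, `p = 2` is the identity
`s a² + t b² - (s a + t b)² = s t (a - b)²`, and the open interval follows from the integral
representation. -/
theorem convexOn_rpow_of_mem_Icc_one_two {p : ℝ} (hp : p ∈ Icc 1 2) :
    ConvexOn ℝ (Ici (0 : A)) (fun a : A => a ^ p) := by
  rcases eq_or_lt_of_le hp.1 with h1 | h1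
  · exact (convexOn_id (convex_Ici 0)).congr fun a ha => by
      rw [← h1, CFC.rpow_one a ha]; rfl
  rcases eq_or_lt_of_le hp.2 with h2 | h2
  · refine ⟨convex_Ici _, fun a ha b hb s t hs ht hst => ?_⟩
    have hab := convex_Ici (0 : A) ha hb hs ht hst
    have hsq : ∀ c : A, 0 ≤ c → c ^ p = c * c := fun c hc => by
      rw [h2, ← pow_two, ← CFC.rpow_natCast c 2 hc]; norm_num
    simp only
    rw [hsq a ha, hsq b hb, hsq _ hab]
    have hst' : t = 1 - s := by linarith
    have key : s • (a * a) + t • (b * b) - (s • a + t • b) * (s • a + t • b) =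
        (s * t) • (star (a - b) * (a - b)) := by
      have hsa : star (a - b) = a - b := by
        rw [star_sub, (IsSelfAdjoint.of_nonneg (show 0 ≤ a from ha)).star_eq,
          (IsSelfAdjoint.of_nonneg (show 0 ≤ b from hb)).star_eq]
      rw [hsa, hst']
      simp only [mul_sub, sub_mul, mul_add, add_mul, smul_mul_assoc, mul_smul_comm, smul_smul,
        smul_sub, smul_add]
      module
    rw [← sub_nonneg, key]
    exact smul_nonneg (by positivity) (star_mul_self_nonneg _)
  · let q : NNReal := ⟨p, by linarith⟩
    have hq : q ∈ Ioo (1 : NNReal) 2 := ⟨by exact_mod_cast h1, by exact_mod_cast h2⟩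
    obtain ⟨μ, hμ⟩ := CFC.exists_measure_nnrpow_eq_integral_cfcₙ_rpowIntegrand₁₂ A hq
    have hE : (Ici (0 : A)).EqOn (fun a : A => a ^ p)
        (fun a : A => ∫ t in Ioi 0, cfcₙ (Real.rpowIntegrand₁₂ q t) a ∂μ) := fun a ha =>
      (CFC.nnrpow_eq_rpow (a := a) (x := q) (zero_lt_one.trans hq.1)).symm.trans (hμ a ha).2
    refine ConvexOn.congr ?_ hE.symm
    refine integral_convexOn_of_integrand_ae (convex_Ici _) ?_ fun a ha => (hμ a ha).1
    filter_upwards [ae_restrict_mem measurableSet_Ioi] with t ht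
    refine (convexOn_cfc_rpowIntegrand₁₂ q ht).congr fun a ha => ?_
    have hcont : ContinuousOn (Real.rpowIntegrand₁₂ q t) (quasispectrum ℝ a) :=
      ((Real.continuousOn_rpowIntegrand₁₂_uncurry (p := q) h1 (Ici 0) le_rfl).uncurry_left t
        ht).mono fun x hx => quasispectrum_nonneg_of_nonneg a ha x hx
    exact (cfcₙ_eq_cfc hcont (Real.rpowIntegrand₁₂_zero ht)).symm

end CStar

section Hilbert

variable {H : Type*} [NormedAddCommGroup H] [InnerProductSpace ℂ H] [CompleteSpace H]

open Set

theorem cfc_rpow_eq {a : H →L[ℂ] H} (ha : IsStrictlyPositive a) (p : ℝ) :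
    cfc (fun t : ℝ => t ^ p) a = a ^ p := (CFC.rpow_eq_cfc_real ha.nonneg).symm

theorem isStrictlyPositive_of_spectrum {a : H →L[ℂ] H} (ha : IsSelfAdjoint a)
    (h : spectrum ℝ a ⊆ Ioi 0) : IsStrictlyPositive a :=
  CStarAlgebra.isStrictlyPositive_iff_isSelfAdjoint_and_spectrum_pos.2 ⟨ha, h⟩

theorem operatorMonotone_rpow {p : ℝ} (hp : p ∈ Icc 0 1) :
    OperatorMonotone H (Ioi 0) (fun t : ℝ => t ^ p) := by
  intro a b ha hb hsa hsb hab
  rw [cfc_rpow_eq (isStrictlyPositive_of_spectrum ha hsa),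
    cfc_rpow_eq (isStrictlyPositive_of_spectrum hb hsb)]
  exact CFC.rpow_le_rpow hp hab

theorem operatorMonotone_neg_rpow {p : ℝ} (hp : p ∈ Icc (-1) 0) :
    OperatorMonotone H (Ioi 0) (fun t : ℝ => -(t ^ p)) := by
  intro a b ha hb hsa hsb hab
  have hb' := isStrictlyPositive_of_spectrum hb hsb
  rw [cfc_neg, cfc_neg, cfc_rpow_eq (isStrictlyPositive_of_spectrum ha hsa), cfc_rpow_eq hb']
  exact neg_le_neg (rpow_le_rpow_of_mem_Icc_neg_one_zero hp hb' hab)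

theorem operatorConvex_rpow {p : ℝ} (hp : (-1 ≤ p ∧ p ≤ 0) ∨ (1 ≤ p ∧ p ≤ 2)) :
    OperatorConvex H (Ioi 0) (fun t : ℝ => t ^ p) := by
  intro a b ha hb hsa hsb c hc0 hc1
  have ha' := isStrictlyPositive_of_spectrum ha hsa
  have hb' := isStrictlyPositive_of_spectrum hb hsb
  have hab := convex_isStrictlyPositive ha' hb' hc0.le (sub_nonneg.2 hc1.le) (by ring)
  rw [cfc_rpow_eq ha', cfc_rpow_eq hb', cfc_rpow_eq hab]
  rcases hp with hp | hp
  · exact (convexOn_rpow_of_mem_Icc_neg_one_zero hp).2 ha' hb' hc0.le (sub_nonneg.2 hc1.le)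
      (by ring)
  · exact (convexOn_rpow_of_mem_Icc_one_two hp).2 ha'.nonneg hb'.nonneg hc0.le
      (sub_nonneg.2 hc1.le) (by ring)

end Hilbert

/-! ### Embedding matrices into an infinite-dimensional Hilbert space -/

section Transfer

open Set
open scoped ComplexOrder MatrixOrder

theorem exists_linearIsometry_euclideanSpace {H : Type*} [NormedAddCommGroup H]
    [InnerProductSpace ℂ H] (hH : ¬ FiniteDimensional ℂ H) (n : ℕ) :
    Nonempty (EuclideanSpace ℂ (Fin n) →ₗᵢ[ℂ] H) := by
  have hrank : (n : Cardinal) ≤ Module.rank ℂ H :=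
    (Cardinal.natCast_lt_aleph0.le).trans (not_lt.1 fun h => hH (Module.rank_lt_aleph0_iff.1 h))
  obtain ⟨s, rfl, hs⟩ := exists_finset_linearIndependent_of_le_rank hrank
  have hW : Module.finrank ℂ (Submodule.span ℂ (s : Set H)) = s.card :=
    finrank_span_finset_eq_card hs
  rw [← hW]
  exact ⟨(Submodule.span ℂ (s : Set H)).subtypeₗᵢ.comp
    (stdOrthonormalBasis ℂ (Submodule.span ℂ (s : Set H))).repr.symm.toLinearIsometry⟩

variable {H : Type*} [NormedAddCommGroup H] [InnerProductSpace ℂ H] [CompleteSpace H] {n : ℕ}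

/-- The corner embedding `M ↦ V M V*` of `n × n` matrices into the bounded operators on `H`, for an
isometry `V : ℂⁿ → H`. It is a non-unital `*`-homomorphism; it is recorded as a real-linear map
because the functional calculus in question is the real one. -/
noncomputable def corner (V : EuclideanSpace ℂ (Fin n) →ₗᵢ[ℂ] H) :
    Matrix (Fin n) (Fin n) ℂ →ₗ[ℝ] (H →L[ℂ] H) where
  toFun M := V.toContinuousLinearMap ∘L Matrix.toEuclideanCLM (𝕜 := ℂ) M ∘L
    ContinuousLinearMap.adjoint V.toContinuousLinearMap
  map_add' M N := by simp [ContinuousLinearMap.comp_add, ContinuousLinearMap.add_comp]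
  map_smul' r M := by
    have : Matrix.toEuclideanCLM (𝕜 := ℂ) (r • M) = r • Matrix.toEuclideanCLM (𝕜 := ℂ) M := by
      ext1 x; ext i; simp [Matrix.smul_mulVec]
    simp [this]

variable (V : EuclideanSpace ℂ (Fin n) →ₗᵢ[ℂ] H)

theorem adjoint_comp_isometry : ContinuousLinearMap.adjoint V.toContinuousLinearMap ∘L
    V.toContinuousLinearMap = 1 := by
  rw [← ContinuousLinearMap.norm_map_iff_adjoint_comp_self]
  exact V.norm_map

theorem adjoint_isometry_apply (y : EuclideanSpace ℂ (Fin n)) :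
    ContinuousLinearMap.adjoint V.toContinuousLinearMap (V y) = y :=
  DFunLike.congr_fun (adjoint_comp_isometry V) y

theorem corner_mul (M N : Matrix (Fin n) (Fin n) ℂ) :
    corner V (M * N) = corner V M * corner V N := by
  ext x
  simp [corner, adjoint_isometry_apply]

theorem star_corner (M : Matrix (Fin n) (Fin n) ℂ) : star (corner V M) = corner V (star M) := by
  simp only [corner, LinearMap.coe_mk, AddHom.coe_mk, map_star,
    ContinuousLinearMap.star_eq_adjoint, ContinuousLinearMap.adjoint_comp,
    ContinuousLinearMap.adjoint_adjoint, ContinuousLinearMap.comp_assoc]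

theorem isPositive_toEuclideanCLM_iff {M : Matrix (Fin n) (Fin n) ℂ} :
    (Matrix.toEuclideanCLM (𝕜 := ℂ) M).IsPositive ↔ M.PosSemidef := by
  rw [← Matrix.isPositive_toEuclideanLin_iff]
  exact (LinearMap.isPositive_toContinuousLinearMap_iff _).symm

theorem corner_nonneg_iff (M : Matrix (Fin n) (Fin n) ℂ) : 0 ≤ corner V M ↔ M.PosSemidef := by
  rw [ContinuousLinearMap.nonneg_iff_isPositive, ← isPositive_toEuclideanCLM_iff]
  refine ⟨fun h => ?_, fun h => h.conj_adjoint V.toContinuousLinearMap⟩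
  have h' := h.adjoint_conj V.toContinuousLinearMap
  convert h' using 1
  ext1 x
  simp [corner, adjoint_isometry_apply]

/-- The block-diagonal extension `M ⊕ 1` of a matrix `M` with respect to the range of the isometry
`V` and its orthogonal complement. The constant `1` on the complement keeps the spectrum in any
set containing `1`. -/
noncomputable def dilation (M : Matrix (Fin n) (Fin n) ℂ) : H →L[ℂ] H :=
  corner V M + (1 - corner V 1)

theorem isSelfAdjoint_dilation {M : Matrix (Fin n) (Fin n) ℂ} (hM : M.IsHermitian) :
    IsSelfAdjoint (dilation V M) := by
  have : star M = M := hM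
  simp [IsSelfAdjoint, dilation, star_corner, this]

theorem corner_add_mul (M N : Matrix (Fin n) (Fin n) ℂ) (r s : ℝ) :
    (corner V M + r • (1 - corner V 1)) * (corner V N + s • (1 - corner V 1)) =
      corner V (M * N) + (r * s) • (1 - corner V 1) := by
  have h1 : corner V M * corner V 1 = corner V M := by rw [← corner_mul, mul_one]
  have h2 : corner V 1 * corner V N = corner V N := by rw [← corner_mul, one_mul]
  have h3 : corner V 1 * corner V 1 = corner V 1 := by rw [← corner_mul, one_mul]
  simp only [mul_add, add_mul, smul_mul_assoc, mul_smul_comm, mul_sub, sub_mul, mul_one, one_mul,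
    h1, h2, h3, corner_mul]
  module

theorem aeval_dilation (M : Matrix (Fin n) (Fin n) ℂ) (q : Polynomial ℝ) :
    Polynomial.aeval (dilation V M) q =
      corner V (Polynomial.aeval M q) + q.eval 1 • (1 - corner V 1) := by
  induction q using Polynomial.induction_on' with
  | add p q hp hq => simp only [map_add, hp, hq, Polynomial.eval_add]; module
  | monomial k a =>
    have hk : dilation V M ^ k = corner V (M ^ k) + (1 : ℝ) • (1 - corner V 1) := by
      induction k with
      | zero => simp
      | succ k ih =>
        have h1 : dilation V M = corner V M + (1 : ℝ) • (1 - corner V 1) := by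
          rw [one_smul]; rfl
        rw [pow_succ, ih, h1, corner_add_mul, pow_succ, mul_one]
    simp only [Polynomial.aeval_monomial, hk, Polynomial.eval_monomial, one_pow, mul_one,
      ← Algebra.smul_def, map_smul]
    module

theorem spectrum_dilation_subset (M : Matrix (Fin n) (Fin n) ℂ) :
    spectrum ℝ (dilation V M) ⊆ insert 1 (spectrum ℝ M) := by
  intro r hr
  by_contra hcon
  simp only [mem_insert_iff, not_or] at hcon
  obtain ⟨hr1, hrM⟩ := hcon
  rw [spectrum.notMem_iff] at hrM
  obtain ⟨u, hu⟩ := hrM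
  refine hr ?_
  have hs : algebraMap ℝ (H →L[ℂ] H) r - dilation V M =
      corner V u + (r - 1) • (1 - corner V 1) := by
    rw [hu, map_sub, Algebra.algebraMap_eq_smul_one, Algebra.algebraMap_eq_smul_one, map_smul,
      dilation]
    module
  have hr1' : r - 1 ≠ 0 := sub_ne_zero.2 hr1
  refine ⟨⟨corner V u + (r - 1) • (1 - corner V 1),
    corner V (↑u⁻¹ : Matrix (Fin n) (Fin n) ℂ) + (r - 1)⁻¹ • (1 - corner V 1), ?_, ?_⟩, hs.symm⟩
  · rw [corner_add_mul, Units.mul_inv, mul_inv_cancel₀ hr1']; module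
  · rw [corner_add_mul, Units.inv_mul, inv_mul_cancel₀ hr1']; module

/-- The spectra of `M` and `dilation V M` are contained in a finite set on which `f` agrees with a
polynomial, so no continuity of `f` is needed. -/
theorem cfc_dilation (f : ℝ → ℝ) {M : Matrix (Fin n) (Fin n) ℂ} (hM : M.IsHermitian) :
    cfc f (dilation V M) = corner V (cfc f M) + f 1 • (1 - corner V 1) := by
  classical
  set S : Finset ℝ := insert 1 (Matrix.finite_real_spectrum (A := M)).toFinset with hS
  set q := Lagrange.interpolate S id f
  have hq : ∀ x ∈ S, f x = q.eval x := fun x hx =>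
    (Lagrange.eval_interpolate_at_node f (injOn_id _) hx).symm
  have hqM : EqOn f (fun x => q.eval x) (spectrum ℝ M) := fun x hx => hq x (by simp [hS, hx])
  have hqD : EqOn f (fun x => q.eval x) (spectrum ℝ (dilation V M)) := fun x hx =>
    hq x (by simpa [hS] using spectrum_dilation_subset V M hx)
  have hMsa : IsSelfAdjoint M := hM
  rw [cfc_congr hqM, cfc_congr hqD, cfc_polynomial q M hMsa,
    cfc_polynomial q _ (isSelfAdjoint_dilation V hM), aeval_dilation, hq 1 (by simp [hS])]

theorem corner_le_corner_iff {M N : Matrix (Fin n) (Fin n) ℂ} :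
    corner V M ≤ corner V N ↔ M ≤ N := by
  rw [← sub_nonneg, ← map_sub, corner_nonneg_iff, Matrix.le_iff]

theorem spectrum_dilation_subset_of_mem {J : Set ℝ} (hJ : 1 ∈ J) {M : Matrix (Fin n) (Fin n) ℂ}
    (hM : spectrum ℝ M ⊆ J) : spectrum ℝ (dilation V M) ⊆ J :=
  (spectrum_dilation_subset V M).trans (insert_subset hJ hM)

/-- Operator monotonicity on an infinite-dimensional Hilbert space passes to matrices of every
size. -/
theorem OperatorMonotone.matrixMonotone {J : Set ℝ} {f : ℝ → ℝ} (h : OperatorMonotone H J f)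
    (hH : ¬ FiniteDimensional ℂ H) (hJ : 1 ∈ J) : MatrixMonotone n J f := by
  intro A B hA hB hsA hsB hBA
  obtain ⟨V⟩ := exists_linearIsometry_euclideanSpace hH n
  have key := h (dilation V A) (dilation V B) (isSelfAdjoint_dilation V hA)
    (isSelfAdjoint_dilation V hB) (spectrum_dilation_subset_of_mem V hJ hsA)
    (spectrum_dilation_subset_of_mem V hJ hsB)
    (by simpa [dilation] using (corner_le_corner_iff V).2 hBA)
  rw [cfc_dilation V f hA, cfc_dilation V f hB, add_le_add_iff_right] at key
  exact (corner_le_corner_iff V).1 key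

/-- Operator convexity on an infinite-dimensional Hilbert space passes to matrices of every size. -/
theorem OperatorConvex.matrixConvex {J : Set ℝ} {f : ℝ → ℝ} (h : OperatorConvex H J f)
    (hH : ¬ FiniteDimensional ℂ H) (hJ : 1 ∈ J) : MatrixConvex n J f := by
  intro A B hA hB hsA hsB c hc0 hc1
  obtain ⟨V⟩ := exists_linearIsometry_euclideanSpace hH n
  have key := h (dilation V A) (dilation V B) (isSelfAdjoint_dilation V hA)
    (isSelfAdjoint_dilation V hB) (spectrum_dilation_subset_of_mem V hJ hsA)
    (spectrum_dilation_subset_of_mem V hJ hsB) c hc0 hc1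
  have hC : (c • A + (1 - c) • B).IsHermitian :=
    (IsSelfAdjoint.smul (IsSelfAdjoint.all c) hA.isSelfAdjoint).add
      (IsSelfAdjoint.smul (IsSelfAdjoint.all _) hB.isSelfAdjoint)
  have h1 : c • dilation V A + (1 - c) • dilation V B = dilation V (c • A + (1 - c) • B) := by
    simp only [dilation, map_add, map_smul]
    module
  have h2 : c • (corner V (cfc f A) + f 1 • (1 - corner V 1)) +
      (1 - c) • (corner V (cfc f B) + f 1 • (1 - corner V 1)) =
      corner V (c • cfc f A + (1 - c) • cfc f B) + f 1 • (1 - corner V 1) := by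
    simp only [map_add, map_smul]
    module
  rw [h1, cfc_dilation V f hA, cfc_dilation V f hB, cfc_dilation V f hC, h2,
    add_le_add_iff_right] at key
  exact (corner_le_corner_iff V).1 key

end Transfer

/-! ### Real symmetric 2 × 2 matrices and the necessity of the exponent ranges -/

section TwoByTwo

open Set Filter Topology
open scoped ComplexOrder MatrixOrder

/-- The symmetric matrix with real entries `a, b, b, c`, as a complex matrix. -/
def symm2 (a b c : ℝ) : Matrix (Fin 2) (Fin 2) ℂ := !![(a : ℂ), b; b, c]

theorem isHermitian_symm2 (a b c : ℝ) : (symm2 a b c).IsHermitian := by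
  ext i j
  fin_cases i <;> fin_cases j <;> simp [symm2]

theorem smul_symm2_add_smul_symm2 (r s a b c a' b' c' : ℝ) :
    r • symm2 a b c + s • symm2 a' b' c' =
      symm2 (r * a + s * a') (r * b + s * b') (r * c + s * c') := by
  ext i j
  fin_cases i <;> fin_cases j <;> simp [symm2]

/-- Elements of the spectrum are roots of the characteristic polynomial. -/
theorem spectrum_symm2 {a b c t : ℝ} (ht : t ∈ spectrum ℝ (symm2 a b c)) :
    (t - a) * (t - c) = b ^ 2 := by
  rw [spectrum.mem_iff, Matrix.isUnit_iff_isUnit_det, isUnit_iff_ne_zero, not_not,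
    Matrix.det_fin_two] at ht
  simp [symm2, Algebra.algebraMap_eq_smul_one] at ht
  have : (((t - a) * (t - c) - b * b : ℝ) : ℂ) = 0 := by push_cast; exact ht
  rw [Complex.ofReal_eq_zero] at this
  linarith

theorem spectrum_symm2_subset_Ioi {a b c : ℝ} (ha : 0 < a) (hc : 0 < c) (h : b ^ 2 < a * c) :
    spectrum ℝ (symm2 a b c) ⊆ Ioi 0 := by
  intro t ht
  have := spectrum_symm2 ht
  by_contra hcon
  have ht0 : t ≤ 0 := not_lt.1 hcon
  nlinarith [mul_nonneg (neg_nonneg.2 ht0) ha.le, mul_nonneg (neg_nonneg.2 ht0) hc.le]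

/-- The value at the real vector `(u, v)` of the quadratic form of a complex `2 × 2` matrix. -/
def quadForm (M : Matrix (Fin 2) (Fin 2) ℂ) (u v : ℝ) : ℝ :=
  (star ![(u : ℂ), v] ⬝ᵥ M.mulVec ![(u : ℂ), v]).re

theorem quadForm_symm2 (a b c u v : ℝ) :
    quadForm (symm2 a b c) u v = a * u ^ 2 + 2 * b * (u * v) + c * v ^ 2 := by
  simp [quadForm, symm2, Matrix.mulVec, dotProduct, Fin.sum_univ_two]
  ring

theorem quadForm_mono {M N : Matrix (Fin 2) (Fin 2) ℂ} (h : M ≤ N) (u v : ℝ) :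
    quadForm M u v ≤ quadForm N u v := by
  have := (Complex.le_def.1 ((Matrix.le_iff.1 h).dotProduct_mulVec_nonneg ![(u : ℂ), v])).1
  rw [Matrix.sub_mulVec, dotProduct_sub, Complex.sub_re, Complex.zero_re] at this
  exact sub_nonneg.1 this

theorem symm2_le_symm2 {a b c a' b' c' p q : ℝ} (h₁ : a' - a = p ^ 2) (h₂ : b' - b = p * q)
    (h₃ : c' - c = q ^ 2) : symm2 a b c ≤ symm2 a' b' c' := by
  rw [Matrix.le_iff]
  have : symm2 a' b' c' - symm2 a b c =
      Matrix.vecMulVec ![(p : ℂ), q] (star ![(p : ℂ), q]) := by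
    ext i j
    fin_cases i <;> fin_cases j <;>
      simp [symm2, Matrix.vecMulVec, ← Complex.ofReal_sub, h₁, h₂, h₃, pow_two, mul_comm]
  rw [this]
  exact Matrix.posSemidef_vecMulVec_self_star _

theorem cfc_affine_symm2 (a b c p q : ℝ) :
    cfc (fun t : ℝ => p * t + q) (symm2 a b c) = symm2 (p * a + q) (p * b) (p * c + q) := by
  have hsa : IsSelfAdjoint (symm2 a b c) := isHermitian_symm2 a b c
  rw [cfc_add_const _ _ _ (by fun_prop), cfc_const_mul _ _ _ (by fun_prop), cfc_id' ℝ _]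
  ext i j
  fin_cases i <;> fin_cases j <;> simp [symm2, Algebra.algebraMap_eq_smul_one]

/-- The functional calculus acts on the diagonal entries. -/
theorem cfc_symm2_diagonal (f : ℝ → ℝ) (a c : ℝ) :
    cfc f (symm2 a 0 c) = symm2 (f a) 0 (f c) := by
  -- For `a = c` the slope is `0 / 0 = 0`, and any slope would do.
  set p := (f c - f a) / (c - a) with hp
  have hpc : p * (c - a) = f c - f a := by
    rcases eq_or_ne c a with rfl | h
    · simp
    · rw [hp, div_mul_cancel₀ _ (sub_ne_zero.2 h)]
  have hf : EqOn f (fun t => p * t + (f a - p * a)) (spectrum ℝ (symm2 a 0 c)) := fun t ht => by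
    have := spectrum_symm2 ht
    rcases mul_eq_zero.1 (this.trans (by norm_num)) with h | h
    · rw [sub_eq_zero.1 h]; ring
    · rw [sub_eq_zero.1 h]; linear_combination -hpc
  rw [cfc_congr hf, cfc_affine_symm2]
  congr 1
  · ring
  · ring
  · linear_combination hpc

/-- The matrix has eigenvalues `a + b` and `a - b`, with eigenvectors `(1, 1)` and `(1, -1)`. -/
theorem cfc_symm2_circulant (f : ℝ → ℝ) (a : ℝ) {b : ℝ} (hb : b ≠ 0) :
    cfc f (symm2 a b a) =
      symm2 ((f (a + b) + f (a - b)) / 2) ((f (a + b) - f (a - b)) / 2)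
        ((f (a + b) + f (a - b)) / 2) := by
  set p := (f (a + b) - f (a - b)) / (2 * b) with hp
  have hpb : p * (2 * b) = f (a + b) - f (a - b) := div_mul_cancel₀ _ (by simpa using hb)
  have hf : EqOn f (fun t => p * t + (f (a + b) - p * (a + b)))
      (spectrum ℝ (symm2 a b a)) := fun t ht => by
    have := spectrum_symm2 ht
    rcases mul_eq_zero.1 (show (t - (a + b)) * (t - (a - b)) = 0 by linear_combination this)
      with h | h
    · rw [sub_eq_zero.1 h]; ring
    · rw [sub_eq_zero.1 h]; linear_combination hpb
  rw [cfc_congr hf, cfc_affine_symm2]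
  clear_value p
  congr 1
  · linear_combination (-1 / 2 : ℝ) * hpb
  · linear_combination (1 / 2 : ℝ) * hpb
  · linear_combination (-1 / 2 : ℝ) * hpb

/-- Pointwise domination on the roots of the characteristic polynomial suffices to compare
functional calculi. -/
theorem quadForm_le_quadForm_cfc {f g : ℝ → ℝ} {a b c : ℝ}
    (h : ∀ t, (t - a) * (t - c) = b ^ 2 → g t ≤ f t) (u v : ℝ) :
    quadForm (cfc g (symm2 a b c)) u v ≤ quadForm (cfc f (symm2 a b c)) u v :=
  quadForm_mono (cfc_mono (fun t ht => h t (spectrum_symm2 ht))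
    (Matrix.finite_real_spectrum.continuousOn _) (Matrix.finite_real_spectrum.continuousOn _)) u v

theorem nonneg_of_continuousAt_of_forall_pos {F : ℝ → ℝ} {r : ℝ} (hr : 0 < r)
    (hF : ContinuousAt F 0) (h : ∀ ε, 0 < ε → ε < r → 0 ≤ F ε) : 0 ≤ F 0 := by
  refine ge_of_tendsto (hF.tendsto.mono_left (nhdsWithin_le_nhds (s := Ioi 0))) ?_
  filter_upwards [Ioo_mem_nhdsGT hr] with ε hε using h ε hε.1 hε.2

/-- Strict convexity of `t ^ p` at the points `1`, `3`, with midpoint `2`. -/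
theorem two_rpow_lt_of_one_lt {p : ℝ} (hp : 1 < p) : (2 : ℝ) ^ p < (3 ^ p + 1) / 2 := by
  have := (strictConvexOn_rpow hp).2 (show (3 : ℝ) ∈ Ici 0 by simp) (show (1 : ℝ) ∈ Ici 0 by simp)
    (by norm_num) (show (0 : ℝ) < 1 / 2 by norm_num) (show (0 : ℝ) < 1 / 2 by norm_num)
    (by norm_num)
  norm_num at this
  linarith

/-- Strict concavity of `t ^ p` at the points `1`, `3`, with midpoint `2`. -/
theorem lt_two_rpow_of_mem_Ioo {p : ℝ} (hp0 : 0 < p) (hp1 : p < 1) :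
    ((3 : ℝ) ^ p + 1) / 2 < 2 ^ p := by
  have := (Real.strictConcaveOn_rpow hp0 hp1).2 (show (3 : ℝ) ∈ Ici 0 by simp)
    (show (1 : ℝ) ∈ Ici 0 by simp)
    (by norm_num) (show (0 : ℝ) < 1 / 2 by norm_num) (show (0 : ℝ) < 1 / 2 by norm_num)
    (by norm_num)
  norm_num at this
  linarith

theorem symm2_one_le_symm2_two : symm2 1 0 1 ≤ symm2 2 0 2 := by
  rw [Matrix.le_iff]
  have : symm2 2 0 2 - symm2 1 0 1 = 1 := by
    ext i j
    fin_cases i <;> fin_cases j <;> simp [symm2]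
    all_goals norm_num
  rw [this]
  exact Matrix.PosSemidef.one

theorem nonneg_of_matrixMonotone_rpow {p : ℝ}
    (h : MatrixMonotone 2 (Ioi 0) (fun t : ℝ => t ^ p)) : 0 ≤ p := by
  have key := quadForm_mono (h (symm2 2 0 2) (symm2 1 0 1) (isHermitian_symm2 _ _ _)
    (isHermitian_symm2 _ _ _) (spectrum_symm2_subset_Ioi (by norm_num) (by norm_num) (by norm_num))
    (spectrum_symm2_subset_Ioi (by norm_num) (by norm_num) (by norm_num))
    symm2_one_le_symm2_two) 1 0
  rw [cfc_symm2_diagonal, cfc_symm2_diagonal, quadForm_symm2, quadForm_symm2] at key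
  by_contra hp
  have := Real.rpow_lt_one_of_one_lt_of_neg (show (1 : ℝ) < 2 by norm_num) (not_le.1 hp)
  norm_num at key
  linarith

theorem nonpos_of_matrixMonotone_neg_rpow {p : ℝ}
    (h : MatrixMonotone 2 (Ioi 0) (fun t : ℝ => -(t ^ p))) : p ≤ 0 := by
  have key := quadForm_mono (h (symm2 2 0 2) (symm2 1 0 1) (isHermitian_symm2 _ _ _)
    (isHermitian_symm2 _ _ _) (spectrum_symm2_subset_Ioi (by norm_num) (by norm_num) (by norm_num))
    (spectrum_symm2_subset_Ioi (by norm_num) (by norm_num) (by norm_num))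
    symm2_one_le_symm2_two) 1 0
  rw [cfc_symm2_diagonal, cfc_symm2_diagonal, quadForm_symm2, quadForm_symm2] at key
  by_contra hp
  have := Real.one_lt_rpow (show (1 : ℝ) < 2 by norm_num) (not_le.1 hp)
  norm_num at key
  linarith

/-- With `P` the projection onto `(1, 1)`, the matrix `diag(1/3, 1)` dominates `P / 2`; comparing
the `p`-th powers at the vector `(3 ^ p, 1)` gives `(3 ^ p + 1) / 2 ≤ 2 ^ p`. Both matrices are
shifted by `ε` to be positive definite, and `ε → 0`. -/
theorem le_one_of_matrixMonotone_rpow {p : ℝ}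
    (h : MatrixMonotone 2 (Ioi 0) (fun t : ℝ => t ^ p)) : p ≤ 1 := by
  by_contra hp
  rw [not_le] at hp
  have key : ∀ ε : ℝ, 0 < ε → ε < 1 → 0 ≤ (1 / 3 + ε) ^ p * ((3 : ℝ) ^ p) ^ 2 + (1 + ε) ^ p -
      (((1 / 2 + ε) ^ p + ε ^ p) / 2 * (((3 : ℝ) ^ p) ^ 2 + 1) +
        ((1 / 2 + ε) ^ p - ε ^ p) * (3 : ℝ) ^ p) := by
    intro ε hε _
    have key := quadForm_mono (h (symm2 (1 / 3 + ε) 0 (1 + ε))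
      (symm2 (1 / 4 + ε) (1 / 4) (1 / 4 + ε))
      (isHermitian_symm2 _ _ _) (isHermitian_symm2 _ _ _)
      (spectrum_symm2_subset_Ioi (by positivity) (by positivity) (by simp; positivity))
      (spectrum_symm2_subset_Ioi (by positivity) (by positivity) (by nlinarith))
      (symm2_le_symm2 (p := 1 / (2 * √3)) (q := -(√3 / 2)) ?_ ?_ ?_)) ((3 : ℝ) ^ p) 1
    · rw [cfc_symm2_diagonal, cfc_symm2_circulant _ _ (by norm_num), quadForm_symm2,
        quadForm_symm2, show 1 / 4 + ε + 1 / 4 = 1 / 2 + ε by ring,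
        show 1 / 4 + ε - 1 / 4 = ε by ring] at key
      linarith
    · rw [div_pow, mul_pow, Real.sq_sqrt (by norm_num)]; ring
    · field_simp; norm_num
    · rw [neg_sq, div_pow, Real.sq_sqrt (by norm_num)]; ring
  have hc : ∀ c : ℝ, Continuous fun ε : ℝ => (c + ε) ^ p := fun c =>
    (continuous_const.add continuous_id).rpow_const fun _ => Or.inr (by linarith)
  have hc0 : Continuous fun ε : ℝ => ε ^ p := continuous_id.rpow_const fun _ => Or.inr (by linarith)
  have h0 := nonneg_of_continuousAt_of_forall_pos one_pos (Continuous.continuousAt (by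
    have := hc (1 / 3); have := hc 1; have := hc (1 / 2); fun_prop)) key
  have hlt := two_rpow_lt_of_one_lt hp
  have h3 : (0 : ℝ) < 3 ^ p := by positivity
  have h2 : (0 : ℝ) < 2 ^ p := by positivity
  simp only [add_zero, Real.zero_rpow (by linarith : p ≠ 0), Real.one_rpow,
    Real.div_rpow zero_le_one zero_le_three, Real.div_rpow zero_le_one zero_le_two, sub_zero] at h0
  have h0' : 0 ≤ (3 : ℝ) ^ p + 1 - ((3 : ℝ) ^ p + 1) ^ 2 / (2 * 2 ^ p) := by
    convert h0 using 1
    field_simp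
    ring
  rw [sub_nonneg, div_le_iff₀ (by positivity)] at h0'
  nlinarith

/-- With `J = (3 ^ (-p) + 1) / 2` and `K = (3 ^ (-p) - 1) / 2`, the vector `(J, K)` is `A ^ (-p)
e₁` for `A = [2, 1; 1, 2]`, so that `⟨(J, K), A ^ p (J, K)⟩ = ⟨e₁, A ^ (-p) e₁⟩ = J`. -/
theorem quadForm_rpow_symm2 (p : ℝ) :
    quadForm (cfc (fun t : ℝ => t ^ p) (symm2 2 1 2)) (((3 : ℝ) ^ (-p) + 1) / 2)
      (((3 : ℝ) ^ (-p) - 1) / 2) = ((3 : ℝ) ^ (-p) + 1) / 2 := by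
  rw [cfc_symm2_circulant _ _ one_ne_zero, quadForm_symm2, Real.rpow_neg (by norm_num)]
  norm_num
  have h3 : (0 : ℝ) < 3 ^ p := by positivity
  field_simp
  ring

/-- The hypothesis says `J ≤ 2 ^ (-p)` for `J = (3 ^ (-p) + 1) / 2`, which contradicts Jensen's
inequality if `1 < -p`. -/
theorem neg_one_le_of_two_rpow_mul_sq_le {p : ℝ}
    (h : 2 ^ p * (((3 : ℝ) ^ (-p) + 1) / 2) ^ 2 ≤ ((3 : ℝ) ^ (-p) + 1) / 2) : -1 ≤ p := by
  by_contra hp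
  have hlt := two_rpow_lt_of_one_lt (p := -p) (by linarith)
  rw [Real.rpow_neg zero_le_two, inv_lt_iff_one_lt_mul₀ (by positivity)] at hlt
  have h3 : (0 : ℝ) < ((3 : ℝ) ^ (-p) + 1) / 2 := by positivity
  nlinarith

/-- The matrix `diag(2 + ε, 2 + 1/ε)` dominates `A = [2, 1; 1, 2]`. Comparing `p`-th powers at the
vector `A ^ (-p) e₁` and letting `ε → 0` gives the inequality of
`neg_one_le_of_two_rpow_mul_sq_le`. -/
theorem neg_one_le_of_matrixMonotone_neg_rpow {p : ℝ}
    (h : MatrixMonotone 2 (Ioi 0) (fun t : ℝ => -(t ^ p))) : -1 ≤ p := by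
  apply neg_one_le_of_two_rpow_mul_sq_le
  set J : ℝ := ((3 : ℝ) ^ (-p) + 1) / 2 with hJ
  set K : ℝ := ((3 : ℝ) ^ (-p) - 1) / 2 with hK
  have key : ∀ ε : ℝ, 0 < ε → ε < 1 → 0 ≤ J - (2 + ε) ^ p * J ^ 2 := by
    intro ε hε _
    have hs : √ε * √ε = ε := Real.mul_self_sqrt hε.le
    have key := quadForm_mono (h (symm2 (2 + ε) 0 (2 + 1 / ε)) (symm2 2 1 2)
      (isHermitian_symm2 _ _ _) (isHermitian_symm2 _ _ _)
      (spectrum_symm2_subset_Ioi (by positivity) (by positivity) (by simp; positivity))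
      (spectrum_symm2_subset_Ioi (by positivity) (by positivity) (by norm_num))
      (symm2_le_symm2 (p := √ε) (q := -(1 / √ε)) ?_ ?_ ?_)) J K
    · have h1 := quadForm_rpow_symm2 p
      rw [cfc_neg, cfc_symm2_diagonal] at key
      have h2 : quadForm (-cfc (fun t : ℝ => t ^ p) (symm2 2 1 2)) J K =
          -quadForm (cfc (fun t : ℝ => t ^ p) (symm2 2 1 2)) J K := by
        rw [quadForm, Matrix.neg_mulVec, dotProduct_neg, Complex.neg_re, quadForm]
      rw [h2, h1, quadForm_symm2] at key
      have h4 : 0 ≤ (2 + 1 / ε) ^ p * K ^ 2 := by positivity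
      linarith
    · rw [pow_two, hs]; ring
    · field_simp; norm_num
    · rw [neg_sq, div_pow, Real.sq_sqrt hε.le]; ring
  have h0 := nonneg_of_continuousAt_of_forall_pos one_pos (continuousAt_const.sub
    (((continuousAt_const.add continuousAt_id).rpow_const (Or.inl (by simp))).mul
      continuousAt_const)) key
  have h0' : 0 ≤ J - (2 + 0) ^ p * J ^ 2 := h0
  rw [add_zero] at h0'
  linarith

theorem one_le_of_matrixConvex_rpow_of_pos {p : ℝ}
    (h : MatrixConvex 2 (Ioi 0) (fun t : ℝ => t ^ p)) (hp0 : 0 < p) : 1 ≤ p := by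
  by_contra hp
  have key := quadForm_mono (h (symm2 3 0 3) (symm2 1 0 1) (isHermitian_symm2 _ _ _)
    (isHermitian_symm2 _ _ _) (spectrum_symm2_subset_Ioi (by norm_num) (by norm_num) (by norm_num))
    (spectrum_symm2_subset_Ioi (by norm_num) (by norm_num) (by norm_num))
    (1 / 2) (by norm_num) (by norm_num)) 1 0
  have e : (1 / 2 : ℝ) * 0 + (1 - 1 / 2) * 0 = 0 := by norm_num
  simp only [smul_symm2_add_smul_symm2, e, cfc_symm2_diagonal, quadForm_symm2] at key
  have := lt_two_rpow_of_mem_Ioo hp0 (not_le.1 hp)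
  norm_num at key
  linarith

/-- Convexity at the midpoint `C` of `diag(2 x - 2, 1)` and `[2, 1; 1, 2]` bounds the `(2, 2)`
entry of `C ^ p` independently of `x`, whereas for `p > 2` this entry grows at least like `x ^ (p
- 2) / 4`. -/
theorem le_two_of_matrixConvex_rpow {p : ℝ}
    (h : MatrixConvex 2 (Ioi 0) (fun t : ℝ => t ^ p)) : p ≤ 2 := by
  by_contra hp
  rw [not_le] at hp
  have key : ∀ x : ℝ, 2 ≤ x → x ^ (p - 2) ≤ 3 + (3 : ℝ) ^ p := by
    intro x hx
    have key := quadForm_mono (h (symm2 (2 * x - 2) 0 1) (symm2 2 1 2) (isHermitian_symm2 _ _ _)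
      (isHermitian_symm2 _ _ _) (spectrum_symm2_subset_Ioi (by linarith) (by norm_num)
        (by norm_num; linarith))
      (spectrum_symm2_subset_Ioi (by norm_num) (by norm_num) (by norm_num))
      (1 / 2) (by norm_num) (by norm_num)) 0 1
    rw [cfc_symm2_diagonal, cfc_symm2_circulant _ _ one_ne_zero] at key
    simp only [smul_symm2_add_smul_symm2] at key
    have e1 : (1 / 2 : ℝ) * (2 * x - 2) + (1 - 1 / 2) * 2 = x := by ring
    have e2 : (1 / 2 : ℝ) * 0 + (1 - 1 / 2) * 1 = 1 / 2 := by ring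
    have e3 : (1 / 2 : ℝ) * 1 + (1 - 1 / 2) * 2 = 3 / 2 := by ring
    rw [e1, e2, e3] at key
    have hx0 : 0 < x ^ (p - 2) := by positivity
    have hb := quadForm_le_quadForm_cfc (f := fun t : ℝ => t ^ p)
      -- The affine function that agrees with `x ^ (p - 2) t (t - 3 / 2)` on the spectrum.
      (g := fun t => x ^ (p - 2) * x * t + x ^ (p - 2) * (1 / 4 - 3 / 2 * x))
      (a := x) (b := 1 / 2) (c := 3 / 2) ?_ 0 1
    · rw [cfc_affine_symm2, quadForm_symm2] at hb
      rw [quadForm_symm2] at key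
      have := hb.trans key
      norm_num at this
      nlinarith
    · intro t ht
      have hg : x ^ (p - 2) * x * t + x ^ (p - 2) * (1 / 4 - 3 / 2 * x) =
          x ^ (p - 2) * (t * (t - 3 / 2)) := by linear_combination (-x ^ (p - 2)) * ht
      have ht0 : 0 < t := by
        by_contra hcon
        nlinarith [not_lt.1 hcon]
      rw [hg]
      rcases le_or_gt t (3 / 2) with h1 | h1
      · have : x ^ (p - 2) * (t * (t - 3 / 2)) ≤ 0 :=
          mul_nonpos_of_nonneg_of_nonpos hx0.le (by nlinarith)
        exact this.trans (by positivity)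
      · have hxt : x ≤ t := by
          by_contra hcon
          nlinarith [not_le.1 hcon]
        calc x ^ (p - 2) * (t * (t - 3 / 2)) ≤ t ^ (p - 2) * t ^ (2 : ℝ) := by
              have h3 : x ^ (p - 2) ≤ t ^ (p - 2) :=
                Real.rpow_le_rpow (by linarith) hxt (by linarith)
              have h4 : t * (t - 3 / 2) ≤ t ^ (2 : ℝ) := by
                rw [Real.rpow_two]; nlinarith
              exact mul_le_mul h3 h4 (by nlinarith) (by positivity)
          _ = t ^ p := by rw [← Real.rpow_add ht0]; ring_nf
  obtain ⟨x, hx2, hx⟩ := ((eventually_ge_atTop (2 : ℝ)).and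
    ((tendsto_rpow_atTop (show 0 < p - 2 by linarith)).eventually_gt_atTop (3 + 3 ^ p))).exists
  exact absurd (key x hx2) (not_le.2 hx)

/-- Convexity is applied to `A = [2, 1; 1, 2]` with weight `1 - ε` and `diag(1, 1/ε²)` with weight
`ε`. The combination has the entry `2 - ε` in the first corner while its other diagonal entry
tends to infinity, so its `p`-th power is in the limit at least `2 ^ p` times the projection onto
`e₁`. Evaluating at `A ^ (-p) e₁` gives the inequality of `neg_one_le_of_two_rpow_mul_sq_le`. -/
theorem neg_one_le_of_matrixConvex_rpow {p : ℝ}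
    (h : MatrixConvex 2 (Ioi 0) (fun t : ℝ => t ^ p)) : -1 ≤ p := by
  by_contra hp
  rw [not_le] at hp
  refine hp.not_ge (neg_one_le_of_two_rpow_mul_sq_le ?_)
  set J : ℝ := ((3 : ℝ) ^ (-p) + 1) / 2 with hJ
  set K : ℝ := ((3 : ℝ) ^ (-p) - 1) / 2 with hK
  have key : ∀ ε : ℝ, 0 < ε → ε < 1 / 2 → 0 ≤ (1 - ε) * J + ε * (J ^ 2 + K ^ 2) -
      (2 - ε) ^ p * (J ^ 2 - 2 * ε * (J * K) / (1 + ε)) := by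
    intro ε hε hε2
    have hε' : 2 < 1 / ε := by rw [lt_div_iff₀ hε]; linarith
    have hb1 : (1 : ℝ) ≤ (1 / ε) ^ 2 := by nlinarith
    have key := quadForm_mono (h (symm2 2 1 2) (symm2 1 0 ((1 / ε) ^ 2))
      (isHermitian_symm2 _ _ _) (isHermitian_symm2 _ _ _)
      (spectrum_symm2_subset_Ioi (by positivity) (by positivity) (by norm_num))
      (spectrum_symm2_subset_Ioi (by positivity) (by positivity) (by simp; positivity))
      (1 - ε) (by linarith) (by linarith)) J K
    have hlin : quadForm ((1 - ε) • cfc (fun t : ℝ => t ^ p) (symm2 2 1 2) +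
        (1 - (1 - ε)) • symm2 (1 ^ p) 0 (((1 / ε) ^ 2) ^ p)) J K =
        (1 - ε) * J + ε * (J ^ 2 + ((1 / ε) ^ 2) ^ p * K ^ 2) := by
      have h1 := quadForm_rpow_symm2 p
      rw [cfc_symm2_circulant _ _ one_ne_zero, quadForm_symm2] at h1
      rw [cfc_symm2_circulant _ _ one_ne_zero, smul_symm2_add_smul_symm2, quadForm_symm2,
        Real.one_rpow]
      linear_combination (1 - ε) * h1
    rw [cfc_symm2_diagonal, hlin, smul_symm2_add_smul_symm2] at key
    set c : ℝ := (1 - ε) * 2 + (1 - (1 - ε)) * (1 / ε) ^ 2 with hc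
    have hcv : c = 2 - 2 * ε + 1 / ε := by rw [hc]; field_simp; ring
    have e1 : (1 - ε) * 2 + (1 - (1 - ε)) * 1 = 2 - ε := by ring
    have e2 : (1 - ε) * 1 + (1 - (1 - ε)) * 0 = 1 - ε := by ring
    rw [e1, e2] at key
    have hd : c - (2 - ε) = (1 - ε) * (1 + ε) / ε := by rw [hcv]; field_simp; ring
    have hd2 : 2 - ε ≤ c - (2 - ε) := by rw [hcv]; linarith
    have hdpos : 0 < c - (2 - ε) := by linarith
    have hm : 0 < (2 - ε) ^ p := Real.rpow_pos_of_pos (by linarith) _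
    have hb := quadForm_le_quadForm_cfc (f := fun t : ℝ => t ^ p)
      -- A line through the points `(2 - ε, (2 - ε) ^ p)` and `(c, 0)`.
      (g := fun t => -((2 - ε) ^ p / (c - (2 - ε))) * t + (2 - ε) ^ p / (c - (2 - ε)) * c)
      (a := 2 - ε) (b := 1 - ε) (c := c) ?_ J K
    · rw [cfc_affine_symm2, quadForm_symm2] at hb
      have hfin := hb.trans key
      have hbp : ((1 / ε) ^ 2) ^ p ≤ 1 := Real.rpow_le_one_of_one_le_of_nonpos hb1 (by linarith)
      have hK2 : ε * (((1 / ε) ^ 2) ^ p * K ^ 2) ≤ ε * K ^ 2 := by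
        gcongr
        exact mul_le_of_le_one_left (sq_nonneg K) hbp
      have e3 :
          (-((2 - ε) ^ p / (c - (2 - ε))) * (2 - ε) + (2 - ε) ^ p / (c - (2 - ε)) * c) * J ^ 2 +
          2 * (-((2 - ε) ^ p / (c - (2 - ε))) * (1 - ε)) * (J * K) +
          (-((2 - ε) ^ p / (c - (2 - ε))) * c + (2 - ε) ^ p / (c - (2 - ε)) * c) * K ^ 2 =
          (2 - ε) ^ p * (J ^ 2 - 2 * ε * (J * K) / (1 + ε)) := by
        have e4 : (2 - ε) ^ p / (c - (2 - ε)) * (c - (2 - ε)) = (2 - ε) ^ p :=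
          div_mul_cancel₀ _ hdpos.ne'
        have e5 : (2 - ε) ^ p / (c - (2 - ε)) * (1 - ε) = (2 - ε) ^ p * ε / (1 + ε) := by
          rw [hd]
          have : 1 - ε ≠ 0 := by linarith
          field_simp
        linear_combination J ^ 2 * e4 - 2 * (J * K) * e5
      rw [e3] at hfin
      linarith
    · intro t ht
      have ht0 : 0 < t := by
        by_contra hcon
        have : t ≤ 0 := not_lt.1 hcon
        nlinarith
      have hg : -((2 - ε) ^ p / (c - (2 - ε))) * t + (2 - ε) ^ p / (c - (2 - ε)) * c =
          (2 - ε) ^ p * ((c - t) / (c - (2 - ε))) := by ring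
      rw [hg]
      rcases le_or_gt t (2 - ε) with h1 | h1
      · have h2 : (c - t) / (c - (2 - ε)) ≤ ((2 - ε) / t) ^ (-p) := by
          have h3 : (1 : ℝ) ≤ (2 - ε) / t := by rwa [one_le_div ht0]
          have h4 : (2 - ε) / t ≤ ((2 - ε) / t) ^ (-p) := by
            simpa using Real.rpow_le_rpow_of_exponent_le h3 (show 1 ≤ -p by linarith)
          refine le_trans ?_ h4
          rw [div_le_div_iff₀ hdpos ht0]
          nlinarith
        calc (2 - ε) ^ p * ((c - t) / (c - (2 - ε))) ≤ (2 - ε) ^ p * ((2 - ε) / t) ^ (-p) := by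
              gcongr
          _ = t ^ p := by
              rw [Real.div_rpow (by linarith) ht0.le, Real.rpow_neg (by linarith),
                Real.rpow_neg ht0.le]
              field_simp
      · have h2 : c ≤ t := by
          by_contra hcon
          nlinarith [not_le.1 hcon]
        have : (c - t) / (c - (2 - ε)) ≤ 0 :=
          div_nonpos_of_nonpos_of_nonneg (by linarith) hdpos.le
        exact (mul_nonpos_of_nonneg_of_nonpos hm.le this).trans (by positivity)
  have hcont : ContinuousAt (fun ε : ℝ => (1 - ε) * J + ε * (J ^ 2 + K ^ 2) -
      (2 - ε) ^ p * (J ^ 2 - 2 * ε * (J * K) / (1 + ε))) 0 := by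
    have h1 : ContinuousAt (fun ε : ℝ => (2 - ε) ^ p) 0 :=
      (continuousAt_const.sub continuousAt_id).rpow_const (Or.inl (by simp))
    have h2 : ContinuousAt (fun ε : ℝ => 2 * ε * (J * K) / (1 + ε)) 0 :=
      ContinuousAt.div (by fun_prop) (by fun_prop) (by simp)
    fun_prop
  have h0 := nonneg_of_continuousAt_of_forall_pos (show (0 : ℝ) < 1 / 2 by norm_num) hcont key
  norm_num at h0
  linarith

end TwoByTwo

/-! ### The real quadratic form of a Loewner matrix -/

section QuadraticForm

open Set

/-- The first divided difference of `f` at `x` and `y`, with the value `f' x` on the diagonal; these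
are the real numbers whose casts are the entries of `loewnerMatrix`. -/
noncomputable def divDiff (f : ℝ → ℝ) (x y : ℝ) : ℝ :=
  if x = y then deriv f x else (f x - f y) / (x - y)

/-- The quadratic form of the Loewner matrix of `f` at the points `t`, evaluated at a real vector
`v`. -/
noncomputable def loewnerForm {n : ℕ} (f : ℝ → ℝ) (t v : Fin n → ℝ) : ℝ :=
  ∑ i, ∑ j, v i * v j * divDiff f (t i) (t j)

theorem divDiff_comm (f : ℝ → ℝ) (x y : ℝ) : divDiff f x y = divDiff f y x := by
  unfold divDiff
  rcases eq_or_ne x y with rfl | h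
  · rfl
  · rw [if_neg h, if_neg h.symm, ← neg_div_neg_eq, neg_sub, neg_sub]

/-- For a real symmetric matrix the form at a complex vector is the sum of the forms at its real and
imaginary parts, and both parts have coordinate sum zero. -/
theorem isCPD_of_iff {n : ℕ} {k : Fin n → Fin n → ℝ} (hk : ∀ i j, k i j = k j i) :
    IsCPD (Matrix.of fun i j => (k i j : ℂ)) ↔
      ∀ v : Fin n → ℝ, ∑ i, v i = 0 → 0 ≤ ∑ i, ∑ j, v i * v j * k i j := by
  have hform : ∀ x : Fin n → ℂ,
      (star x ⬝ᵥ (Matrix.of fun i j => (k i j : ℂ)).mulVec x).re =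
        ∑ i, ∑ j, (x i).re * (x j).re * k i j + ∑ i, ∑ j, (x i).im * (x j).im * k i j := by
    intro x
    simp only [dotProduct, Matrix.mulVec, Matrix.of_apply, Pi.star_apply, Complex.re_sum,
      Finset.mul_sum, ← Finset.sum_add_distrib]
    refine Finset.sum_congr rfl fun i _ => Finset.sum_congr rfl fun j _ => ?_
    simp
    ring
  constructor
  · rintro ⟨-, h⟩ v hv
    have := h (fun i => (v i : ℂ)) (by rw [← Complex.ofReal_sum, hv, Complex.ofReal_zero])
    rw [hform] at this
    simpa using this
  · refine fun h => ⟨?_, fun x hx => ?_⟩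
    · ext i j
      simp [hk i j]
    · rw [hform]
      refine add_nonneg (h _ ?_) (h _ ?_)
      · rw [← Complex.re_sum, hx, Complex.zero_re]
      · rw [← Complex.im_sum, hx, Complex.zero_im]

theorem isCPD_loewnerMatrix_iff {n : ℕ} (f : ℝ → ℝ) (t : Fin n → ℝ) :
    IsCPD (loewnerMatrix f t) ↔ ∀ v : Fin n → ℝ, ∑ i, v i = 0 → 0 ≤ loewnerForm f t v :=
  isCPD_of_iff fun i j => divDiff_comm f (t i) (t j)

theorem isCND_loewnerMatrix_iff {n : ℕ} (f : ℝ → ℝ) (t : Fin n → ℝ) :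
    IsCND (loewnerMatrix f t) ↔ ∀ v : Fin n → ℝ, ∑ i, v i = 0 → loewnerForm f t v ≤ 0 := by
  have h : -loewnerMatrix f t = Matrix.of fun i j => ((-divDiff f (t i) (t j) : ℝ) : ℂ) := by
    ext i j
    exact (Complex.ofReal_neg (divDiff f (t i) (t j))).symm
  rw [IsCND, h, isCPD_of_iff fun i j => by rw [divDiff_comm f (t i) (t j)]]
  simp only [mul_neg, Finset.sum_neg_distrib, neg_nonneg]
  rfl

theorem divDiff_rpow (p x y : ℝ) : divDiff (fun s : ℝ => s ^ p) x y =
    if x = y then p * x ^ (p - 1) else (x ^ p - y ^ p) / (x - y) := by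
  rw [divDiff, Real.deriv_rpow_const]

theorem continuous_divDiff_rpow {x y : ℝ} (hx : 0 < x) (hy : 0 < y) :
    Continuous fun p : ℝ => divDiff (fun s : ℝ => s ^ p) x y := by
  simp only [divDiff_rpow]
  have h1 := Real.continuous_const_rpow hx.ne'
  have h2 := Real.continuous_const_rpow hy.ne'
  split_ifs
  · exact continuous_id.mul (h1.comp (continuous_id.sub continuous_const))
  · exact (h1.sub h2).div_const _

theorem continuous_loewnerForm_rpow {n : ℕ} {t : Fin n → ℝ} (ht : ∀ i, 0 < t i) (v : Fin n → ℝ) :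
    Continuous fun p : ℝ => loewnerForm (fun s : ℝ => s ^ p) t v :=
  continuous_finsetSum _ fun i _ => continuous_finsetSum _ fun j _ =>
    continuous_const.mul (continuous_divDiff_rpow (ht i) (ht j))

theorem divDiff_rpow_add_one (p : ℝ) {x y : ℝ} (hx : 0 < x) (hy : 0 < y) :
    divDiff (fun s : ℝ => s ^ (p + 1)) x y = x * divDiff (fun s : ℝ => s ^ p) x y + y ^ p := by
  simp only [divDiff_rpow]
  split_ifs with h
  · subst h
    have h1 : x ^ (p - 1) * x = x ^ p := by
      rw [← Real.rpow_add_one hx.ne']; ring_nf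
    rw [add_sub_cancel_right]
    linear_combination (-p) * h1
  · have := sub_ne_zero.2 h
    rw [Real.rpow_add_one hx.ne', Real.rpow_add_one hy.ne']
    field_simp
    ring

end QuadraticForm

/-! ### Loewner matrices at two points -/

section Trapezoid

open Set

/-- The trapezoid rule overestimates the integral of a convex derivative. -/
theorem two_mul_sub_le_of_convexOn_deriv {f g : ℝ → ℝ} (hg : ConvexOn ℝ (Ioi 0) g)
    (hf : ∀ x, 0 < x → HasDerivAt f (g x) x) {x y : ℝ} (hx : 0 < x) (hxy : x < y) :
    2 * (f y - f x) ≤ (y - x) * (g x + g y) := by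
  set s := (g y - g x) / (y - x) with hs
  have hsy : s * (y - x) = g y - g x := div_mul_cancel₀ _ (sub_pos.2 hxy).ne'
  have hderiv : ∀ t, 0 < t → HasDerivAt (fun t => g x * t + s * (t - x) ^ 2 / 2 - f t)
      (g x + s * (t - x) - g t) t := fun t ht => by
    have h1 : HasDerivAt (fun t => g x * t + s * (t - x) ^ 2 / 2) (g x + s * (t - x)) t := by
      have h2 := ((hasDerivAt_id t).sub_const x).pow 2
      have h3 := ((hasDerivAt_id t).const_mul (g x)).add ((h2.const_mul s).div_const 2)
      refine h3.congr_deriv ?_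
      simp
      ring
    exact h1.sub (hf t ht)
  have hmono : MonotoneOn (fun t => g x * t + s * (t - x) ^ 2 / 2 - f t) (Icc x y) := by
    refine monotoneOn_of_deriv_nonneg (convex_Icc x y)
      (fun t ht => (hderiv t (hx.trans_le ht.1)).continuousAt.continuousWithinAt)
      (fun t ht => ?_) fun t ht => ?_
    · rw [interior_Icc] at ht
      exact (hderiv t (hx.trans ht.1)).differentiableAt.differentiableWithinAt
    · rw [interior_Icc] at ht
      rw [(hderiv t (hx.trans ht.1)).deriv]
      have := hg.secant_mono (a := x) (x := t) (y := y) hx (hx.trans ht.1) (hx.trans hxy)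
        ht.1.ne' hxy.ne' ht.2.le
      rw [div_le_iff₀ (sub_pos.2 ht.1)] at this
      linarith
  have := hmono (left_mem_Icc.2 hxy.le) (right_mem_Icc.2 hxy.le) hxy.le
  simp only [sub_self] at this
  nlinarith

theorem convexOn_rpow_of_nonpos {p : ℝ} (hp : p ≤ 0) :
    ConvexOn ℝ (Ioi 0) fun x : ℝ => x ^ p := by
  have hd : ∀ x ∈ Ioi (0 : ℝ), DifferentiableAt ℝ (fun x : ℝ => x ^ p) x := fun x hx =>
    (Real.hasDerivAt_rpow_const (Or.inl (ne_of_gt hx))).differentiableAt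
  refine MonotoneOn.convexOn_of_deriv (convex_Ioi 0)
    (fun x hx => (hd x hx).continuousAt.continuousWithinAt)
    (fun x hx => (hd x (interior_subset hx)).differentiableWithinAt) ?_
  rw [interior_Ioi]
  intro x hx y hy hxy
  rw [Real.deriv_rpow_const, Real.deriv_rpow_const]
  exact mul_le_mul_of_nonpos_left (Real.rpow_le_rpow_of_nonpos hx hxy (by linarith)) hp

theorem trapezoid_rpow_of_two_le {p : ℝ} (hp : 2 ≤ p) {x y : ℝ} (hx : 0 < x) (hxy : x < y) :
    2 * (y ^ p - x ^ p) ≤ (y - x) * (p * x ^ (p - 1) + p * y ^ (p - 1)) :=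
  two_mul_sub_le_of_convexOn_deriv (f := fun s => s ^ p) (g := fun s => p * s ^ (p - 1))
    (((convexOn_rpow (by linarith)).subset Ioi_subset_Ici_self (convex_Ioi 0)).smul
      (by linarith)) (fun s hs => Real.hasDerivAt_rpow_const (Or.inl hs.ne')) hx hxy

theorem trapezoid_rpow_of_nonpos {p : ℝ} (hp : p ≤ 0) {x y : ℝ} (hx : 0 < x) (hxy : x < y) :
    (y - x) * (p * x ^ (p - 1) + p * y ^ (p - 1)) ≤ 2 * (y ^ p - x ^ p) := by
  have := two_mul_sub_le_of_convexOn_deriv (f := fun s => -s ^ p) (g := fun s => -p * s ^ (p - 1))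
    ((convexOn_rpow_of_nonpos (by linarith)).smul (by linarith))
    (fun s hs => ((Real.hasDerivAt_rpow_const (p := p) (Or.inl hs.ne')).neg).congr_deriv (by ring))
    hx hxy
  linarith

theorem loewnerForm_two_rpow (p : ℝ) {t v : Fin 2 → ℝ} (hv : ∑ i, v i = 0) :
    loewnerForm (fun s : ℝ => s ^ p) t v = v 0 ^ 2 * (p * t 0 ^ (p - 1) + p * t 1 ^ (p - 1) -
      2 * divDiff (fun s : ℝ => s ^ p) (t 0) (t 1)) := by
  have hv1 : v 1 = -v 0 := by rw [Fin.sum_univ_two] at hv; linarith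
  simp only [loewnerForm, Fin.sum_univ_two, hv1, divDiff_comm _ (t 1) (t 0)]
  rw [show divDiff (fun s : ℝ => s ^ p) (t 0) (t 0) = p * t 0 ^ (p - 1) by simp [divDiff_rpow],
    show divDiff (fun s : ℝ => s ^ p) (t 1) (t 1) = p * t 1 ^ (p - 1) by simp [divDiff_rpow]]
  ring

theorem loewnerForm_two_nonneg {p : ℝ} (hp : 2 ≤ p) {t v : Fin 2 → ℝ} (ht : ∀ i, 0 < t i)
    (hv : ∑ i, v i = 0) : 0 ≤ loewnerForm (fun s : ℝ => s ^ p) t v := by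
  rw [loewnerForm_two_rpow p hv]
  refine mul_nonneg (sq_nonneg _) ?_
  rw [divDiff_rpow]
  rcases lt_trichotomy (t 0) (t 1) with h | h | h
  · have h' := sub_pos.2 h
    have := trapezoid_rpow_of_two_le hp (ht 0) h
    rw [if_neg h.ne, ← neg_div_neg_eq, neg_sub, neg_sub, sub_nonneg, ← mul_div_assoc,
      div_le_iff₀ h']
    linarith
  · rw [if_pos h, h]; linarith
  · have h' := sub_pos.2 h
    have := trapezoid_rpow_of_two_le hp (ht 1) h
    rw [if_neg h.ne', sub_nonneg, ← mul_div_assoc, div_le_iff₀ h']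
    linarith

theorem loewnerForm_two_nonpos {p : ℝ} (hp : p ≤ 0) {t v : Fin 2 → ℝ} (ht : ∀ i, 0 < t i)
    (hv : ∑ i, v i = 0) : loewnerForm (fun s : ℝ => s ^ p) t v ≤ 0 := by
  rw [loewnerForm_two_rpow p hv]
  refine mul_nonpos_of_nonneg_of_nonpos (sq_nonneg _) ?_
  rw [divDiff_rpow]
  rcases lt_trichotomy (t 0) (t 1) with h | h | h
  · have h' := sub_pos.2 h
    have := trapezoid_rpow_of_nonpos hp (ht 0) h
    rw [if_neg h.ne, ← neg_div_neg_eq, neg_sub, neg_sub, sub_nonpos, ← mul_div_assoc,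
      le_div_iff₀ h']
    linarith
  · rw [if_pos h, h]; linarith
  · have h' := sub_pos.2 h
    have := trapezoid_rpow_of_nonpos hp (ht 1) h
    rw [if_neg h.ne', sub_nonpos, ← mul_div_assoc, le_div_iff₀ h']
    linarith

/-- If the trapezoid rule is exact for the derivative of `t ^ p` on `[1, 2]` and on `[1, 4]`, then
eliminating `2 ^ p` from the two equations leaves `p (p - 1) (p - 2) = 0`. -/
theorem exponent_of_loewnerForm_two_eq_zero {p : ℝ}
    (h : ∀ t : Fin 2 → ℝ, (∀ i, 0 < t i) → loewnerForm (fun s : ℝ => s ^ p) t ![1, -1] = 0) :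
    p = 0 ∨ p = 1 ∨ p = 2 := by
  have h2 := h ![2, 1] (by intro i; fin_cases i <;> norm_num)
  have h4 := h ![4, 1] (by intro i; fin_cases i <;> norm_num)
  rw [loewnerForm_two_rpow p (by simp), divDiff_rpow] at h2 h4
  have e2 : (2 : ℝ) ^ (p - 1) = 2 ^ p / 2 := Real.rpow_sub_one two_ne_zero p
  have e4 : (4 : ℝ) ^ (p - 1) = 2 ^ p * 2 ^ p / 4 := by
    rw [Real.rpow_sub_one four_ne_zero, ← Real.mul_rpow zero_le_two zero_le_two]; norm_num
  have e4' : (4 : ℝ) ^ p = 2 ^ p * 2 ^ p := by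
    rw [← Real.mul_rpow zero_le_two zero_le_two]; norm_num
  simp [e2, e4, e4'] at h2 h4
  -- From here `2 ^ p` is treated as an unknown `z`, with `4 ^ p = z ^ 2`.
  generalize (2 : ℝ) ^ p = z at h2 h4
  norm_num at h2 h4
  have h2' : z * (4 - p) = 2 * (2 + p) := by linarith
  have h4' : z ^ 2 * (8 - 3 * p) = 4 * (2 + 3 * p) := by linarith
  have : p * ((p - 1) * (p - 2)) = 0 := by
    have h5 : (z * (4 - p)) ^ 2 * (8 - 3 * p) = (4 * (2 + 3 * p)) * (4 - p) ^ 2 := by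
      rw [← h4']; ring
    rw [h2'] at h5
    linarith
  rcases mul_eq_zero.1 this with h | h
  · exact Or.inl h
  · rcases mul_eq_zero.1 h with h | h
    · exact Or.inr (Or.inl (by linarith))
    · exact Or.inr (Or.inr (by linarith))

end Trapezoid

/-! ### Integral representation of divided differences -/

section Integral

open Set MeasureTheory Filter Topology

/-- The divided difference at `x, y` of the function `s ↦ s ^ m / (t + s)`, given by the recursion
`[s g](x, y) = x [g](x, y) + g y`, which also covers the diagonal `x = y`. -/
noncomputable def resolventKernel : ℕ → ℝ → ℝ → ℝ → ℝ
  | 0, t, x, y => -((t + x)⁻¹ * (t + y)⁻¹)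
  | m + 1, t, x, y => x * resolventKernel m t x y + y ^ m * (t + y)⁻¹

/-- For `m ≤ 3` the divided difference of `s ^ m / (t + s)` is a multiple of
`1 / ((t + x) (t + y))` plus terms of the form `g x + g y`, which do not contribute on vectors of
coordinate sum zero. -/
theorem sum_resolventKernel_eq {m : ℕ} (hm : m ≤ 3) {n : ℕ} {s : ℝ} (hs : 0 < s) {t v : Fin n → ℝ}
    (ht : ∀ i, 0 < t i) (hv : ∑ i, v i = 0) :
    ∑ i, ∑ j, v i * v j * resolventKernel m s (t i) (t j) =
      (-1) ^ (m + 1) * s ^ m * (∑ i, v i * (s + t i)⁻¹) ^ 2 := by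
  have hclosed : ∃ a : ℝ, ∀ x y : ℝ, 0 < x → 0 < y → resolventKernel m s x y =
      (-1) ^ (m + 1) * s ^ m * ((s + x)⁻¹ * (s + y)⁻¹) +
        (if m = 3 then x + y else 0) + a := by
    interval_cases m
    · exact ⟨0, fun x y hx hy => by simp [resolventKernel]⟩
    · refine ⟨0, fun x y hx hy => ?_⟩
      have hx' : s + x ≠ 0 := by positivity
      have hy' : s + y ≠ 0 := by positivity
      simp [resolventKernel]
      field_simp
      ring
    · refine ⟨1, fun x y hx hy => ?_⟩
      have hx' : s + x ≠ 0 := by positivity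
      have hy' : s + y ≠ 0 := by positivity
      simp [resolventKernel]
      field_simp
      ring
    · refine ⟨-s, fun x y hx hy => ?_⟩
      have hx' : s + x ≠ 0 := by positivity
      have hy' : s + y ≠ 0 := by positivity
      simp [resolventKernel]
      field_simp
      ring
  obtain ⟨a, ha⟩ := hclosed
  set b : ℝ := if m = 3 then 1 else 0 with hb
  have h1 : ∀ i j, v i * v j * resolventKernel m s (t i) (t j) =
      (-1) ^ (m + 1) * s ^ m * ((v i * (s + t i)⁻¹) * (v j * (s + t j)⁻¹)) +
        (b * (v i * t i)) * v j + v i * (b * (v j * t j)) + a * v i * v j := fun i j => by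
    rw [ha _ _ (ht i) (ht j), show (if m = 3 then t i + t j else 0) = b * (t i + t j) by
      rw [hb]; split_ifs <;> ring]
    ring
  simp only [h1, Finset.sum_add_distrib, ← Finset.mul_sum, ← Finset.sum_mul, hv, pow_two]
  ring

/-- The negative powers `x ^ (p - 1)`, `0 < p < 1`, are superpositions of resolvents. -/
theorem exists_measure_rpow_sub_one_eq_integral {p : ℝ} (hp : p ∈ Ioo 0 1) :
    ∃ μ : Measure ℝ, (∀ᵐ t ∂μ, 0 < t) ∧ ∀ x : ℝ, 0 < x →
      Integrable (fun t => t ^ (p - 1) * (t + x)⁻¹) μ ∧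
        x ^ (p - 1) = ∫ t, t ^ (p - 1) * (t + x)⁻¹ ∂μ := by
  obtain ⟨μ, hμ⟩ := Real.exists_measure_rpow_eq_integral_rpowIntegrand₀₁ hp
  refine ⟨μ.restrict (Ioi 0), ae_restrict_mem measurableSet_Ioi, fun x hx => ?_⟩
  obtain ⟨h1, h2⟩ := hμ x hx.le
  have he : (fun t => x⁻¹ * Real.rpowIntegrand₀₁ p t x) =ᵐ[μ.restrict (Ioi 0)]
      fun t => t ^ (p - 1) * (t + x)⁻¹ := by
    filter_upwards [ae_restrict_mem measurableSet_Ioi] with t ht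
    rw [Real.rpowIntegrand₀₁_eq_pow_div hp (le_of_lt ht) hx.le]
    field_simp
  refine ⟨(h1.const_mul x⁻¹).congr he, ?_⟩
  rw [← integral_congr_ae he, integral_const_mul, ← h2, Real.rpow_sub_one hx.ne', div_eq_inv_mul]

/-- Divided differences of `s ^ (m + p - 1)`, on and off the diagonal, are superpositions of
`resolventKernel m`. -/
theorem exists_measure_divDiff_rpow_eq_integral {p : ℝ} (hp : p ∈ Ioo 0 1) :
    ∃ μ : Measure ℝ, (∀ᵐ t ∂μ, 0 < t) ∧ ∀ m : ℕ, ∀ x y : ℝ, 0 < x → 0 < y →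
      Integrable (fun t => t ^ (p - 1) * resolventKernel m t x y) μ ∧
        divDiff (fun s : ℝ => s ^ (m + (p - 1))) x y =
          ∫ t, t ^ (p - 1) * resolventKernel m t x y ∂μ := by
  obtain ⟨μ, hpos, hμ⟩ := exists_measure_rpow_sub_one_eq_integral hp
  have hint : ∀ x y : ℝ, 0 < x → 0 < y →
      Integrable (fun t => t ^ (p - 1) * ((t + x)⁻¹ * (t + y)⁻¹)) μ := by
    intro x y hx hy
    have h := ((hμ x hx).1.mul_bdd (c := y⁻¹) (g := fun t => (t + y)⁻¹)
      (by fun_prop) ?_)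
    · refine h.congr (Eventually.of_forall fun t => ?_)
      simp only; ring
    · filter_upwards [hpos] with t ht
      rw [Real.norm_of_nonneg (by positivity)]
      exact inv_anti₀ hy (by linarith)
  have hoff : ∀ x y : ℝ, 0 < x → 0 < y →
      (y - x) * ∫ t, t ^ (p - 1) * ((t + x)⁻¹ * (t + y)⁻¹) ∂μ = x ^ (p - 1) - y ^ (p - 1) := by
    intro x y hx hy
    rw [(hμ x hx).2, (hμ y hy).2, ← integral_sub (hμ x hx).1 (hμ y hy).1, ← integral_const_mul]
    refine integral_congr_ae ?_
    filter_upwards [hpos] with t ht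
    have : t + x ≠ 0 := by positivity
    have : t + y ≠ 0 := by positivity
    field_simp
    ring
  have hanti : ∀ x y z : ℝ, 0 < x → 0 < y → y ≤ z →
      ∫ t, t ^ (p - 1) * ((t + x)⁻¹ * (t + z)⁻¹) ∂μ ≤
        ∫ t, t ^ (p - 1) * ((t + x)⁻¹ * (t + y)⁻¹) ∂μ := by
    intro x y z hx hy hyz
    refine integral_mono_ae (hint x z hx (hy.trans_le hyz)) (hint x y hx hy) ?_
    filter_upwards [hpos] with t ht
    gcongr
  have hslope : ∀ x y : ℝ, 0 < x → 0 < y → y ≠ x → slope (fun s : ℝ => s ^ (p - 1)) x y =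
      -∫ t, t ^ (p - 1) * ((t + x)⁻¹ * (t + y)⁻¹) ∂μ := by
    intro x y hx hy hxy
    have h := hoff x y hx hy
    rw [slope_def_field, div_eq_iff (sub_ne_zero.2 hxy)]
    linarith
  -- The diagonal value is squeezed between the slopes on either side, since the integral is
  -- antitone in each argument; this avoids differentiating under the integral sign.
  have hdiag : ∀ x : ℝ, 0 < x → (p - 1) * x ^ (p - 1 - 1) =
      -∫ t, t ^ (p - 1) * ((t + x)⁻¹ * (t + x)⁻¹) ∂μ := by
    intro x hx
    have hd := hasDerivAt_iff_tendsto_slope.1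
      (Real.hasDerivAt_rpow_const (x := x) (p := p - 1) (Or.inl hx.ne'))
    apply le_antisymm
    · refine le_of_tendsto (hd.mono_left
        (nhdsWithin_mono x (s := Iio x) fun y hy => ne_of_lt hy)) ?_
      filter_upwards [Ioo_mem_nhdsLT hx] with y hy
      rw [hslope x y hx hy.1 hy.2.ne]
      exact neg_le_neg (hanti x y x hx hy.1 hy.2.le)
    · refine ge_of_tendsto (hd.mono_left
        (nhdsWithin_mono x (s := Ioi x) fun y hy => ne_of_gt hy)) ?_
      filter_upwards [self_mem_nhdsWithin] with y hy
      rw [hslope x y hx (hx.trans hy) (ne_of_gt hy)]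
      exact neg_le_neg (hanti x x y hx hx (le_of_lt hy))
  refine ⟨μ, hpos, fun m => ?_⟩
  induction m with
  | zero =>
    intro x y hx hy
    refine ⟨by simpa [resolventKernel] using (hint x y hx hy).neg, ?_⟩
    simp only [resolventKernel, mul_neg, integral_neg, CharP.cast_eq_zero, zero_add, divDiff_rpow]
    split_ifs with h
    · rw [← h, hdiag x hx]
    · rw [div_eq_iff (sub_ne_zero.2 h), ← hoff x y hx hy]; ring
  | succ m ih =>
    intro x y hx hy
    obtain ⟨h1, h2⟩ := ih x y hx hy
    have he : (fun t => t ^ (p - 1) * resolventKernel (m + 1) t x y) = fun t =>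
        x * (t ^ (p - 1) * resolventKernel m t x y) + y ^ m * (t ^ (p - 1) * (t + y)⁻¹) := by
      ext t
      simp only [resolventKernel]
      ring
    have hi1 := h1.const_mul x
    have hi2 := (hμ y hy).1.const_mul (y ^ m)
    rw [he]
    refine ⟨hi1.add hi2, ?_⟩
    rw [integral_add hi1 hi2, integral_const_mul, integral_const_mul, ← h2, ← (hμ y hy).2,
      ← Real.rpow_natCast y m, ← Real.rpow_add hy, ← divDiff_rpow_add_one _ hx hy]
    congr 1
    ext s
    congr 1
    push_cast
    ring

/-- For exponents in `[m - 1, m]` with `m ≤ 3`, the Loewner matrices of any size are conditionally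
definite, with sign `(-1) ^ (m + 1)`. The endpoints follow from continuity in the exponent. -/
theorem loewnerForm_rpow_sign {m : ℕ} (hm : m ≤ 3) {a : ℝ} (ha : a ∈ Icc ((m : ℝ) - 1) m) {n : ℕ}
    {t v : Fin n → ℝ} (ht : ∀ i, 0 < t i) (hv : ∑ i, v i = 0) :
    0 ≤ (-1) ^ (m + 1) * loewnerForm (fun s : ℝ => s ^ a) t v := by
  have hopen : ∀ a ∈ Ioo ((m : ℝ) - 1) m,
      0 ≤ (-1) ^ (m + 1) * loewnerForm (fun s : ℝ => s ^ a) t v := by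
    intro a ha
    obtain ⟨μ, hpos, hμ⟩ := exists_measure_divDiff_rpow_eq_integral (p := a - m + 1)
      ⟨by linarith [ha.1], by linarith [ha.2]⟩
    have hexp : (m : ℝ) + (a - m + 1 - 1) = a := by ring
    have hform : loewnerForm (fun s : ℝ => s ^ a) t v =
        ∫ s, s ^ (a - m + 1 - 1) * ∑ i, ∑ j, v i * v j * resolventKernel m s (t i) (t j) ∂μ := by
      have h1 : ∀ i j, Integrable (fun s => v i * v j *
          (s ^ (a - m + 1 - 1) * resolventKernel m s (t i) (t j))) μ := fun i j =>
        (hμ m (t i) (t j) (ht i) (ht j)).1.const_mul _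
      simp only [Finset.mul_sum, mul_left_comm _ (v _ * v _)]
      rw [integral_finsetSum _ fun i _ => integrable_finsetSum _ fun j _ => h1 i j]
      refine Finset.sum_congr rfl fun i _ => ?_
      rw [integral_finsetSum _ fun j _ => h1 i j]
      refine Finset.sum_congr rfl fun j _ => ?_
      rw [integral_const_mul, ← (hμ m (t i) (t j) (ht i) (ht j)).2, hexp]
    rw [hform, ← integral_const_mul]
    refine integral_nonneg_of_ae ?_
    filter_upwards [hpos] with s hs
    rw [sum_resolventKernel_eq hm hs ht hv]
    have h1 : ((-1 : ℝ) ^ (m + 1)) * (-1) ^ (m + 1) = 1 := by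
      rw [← mul_pow]; norm_num
    have h2 : 0 ≤ s ^ (a - m + 1 - 1) * (s ^ m * (∑ i, v i * (s + t i)⁻¹) ^ 2) := by positivity
    calc (0 : ℝ) ≤ _ := h2
      _ = ((-1) ^ (m + 1) * (-1) ^ (m + 1)) *
          (s ^ (a - m + 1 - 1) * (s ^ m * (∑ i, v i * (s + t i)⁻¹) ^ 2)) := by rw [h1, one_mul]
      _ = _ := by ring
  have hcl : closure (Ioo ((m : ℝ) - 1) m) = Icc ((m : ℝ) - 1) m :=
    closure_Ioo (by linarith)
  rw [← hcl] at ha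
  exact closure_minimal hopen (isClosed_le continuous_const
    (continuous_const.mul (continuous_loewnerForm_rpow ht v))) ha

end Integral

/-! ### Loewner matrices at three points: necessary conditions -/

section Necessity

open Set

/-- Repeating a point embeds the forms at two points into the forms at three points. -/
theorem loewnerForm_three_duplicate (f : ℝ → ℝ) (t v : Fin 2 → ℝ) :
    loewnerForm f ![t 0, t 1, t 1] ![v 0, v 1, 0] = loewnerForm f t v := by
  simp [loewnerForm, Fin.sum_univ_three, Fin.sum_univ_two]

theorem loewnerForm_three_rpow (p : ℝ) {r x : ℝ} (hrx : r ≠ x) (hr1 : r ≠ 1) (hx1 : x ≠ 1)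
    (q : ℝ) :
    loewnerForm (fun s : ℝ => s ^ p) ![r, x, 1] ![-(q + 1), q, 1] =
      (q + 1) ^ 2 * (p * r ^ (p - 1)) - 2 * (q + 1) * q * ((x ^ p - r ^ p) / (x - r)) -
        2 * (q + 1) * ((1 - r ^ p) / (1 - r)) + q ^ 2 * (p * x ^ (p - 1)) +
        2 * q * ((1 - x ^ p) / (1 - x)) + p := by
  simp only [loewnerForm, Fin.sum_univ_three, Matrix.cons_val_zero, Matrix.cons_val_one,
    Matrix.cons_val_two, Matrix.head_cons, Matrix.tail_cons]
  rw [divDiff_comm _ r x, divDiff_comm _ r 1, divDiff_comm _ x 1]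
  simp only [divDiff_rpow, if_neg hrx.symm, if_neg hr1.symm, if_neg hx1.symm, if_true,
    Real.one_rpow]
  ring

theorem sum_three_eq_zero (q : ℝ) : ∑ i, (![-(q + 1), q, 1] : Fin 3 → ℝ) i = 0 := by
  simp [Fin.sum_univ_three]

/-- The form at the points `r, x, 1` and the vector `(-(q + 1), q, 1)` with `q = -p / x` is
evaluated in the limit `r → 0` and then `x → 0`. For `p > 3` it tends to `-p - 2 < 0`. -/
theorem le_three_of_loewnerForm_nonneg {p : ℝ}
    (h : ∀ t v : Fin 3 → ℝ, (∀ i, 0 < t i) → ∑ i, v i = 0 →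
      0 ≤ loewnerForm (fun s : ℝ => s ^ p) t v) : p ≤ 3 := by
  by_contra hp
  rw [not_le] at hp
  have h1 : ∀ x : ℝ, 0 < x → x < 1 → 0 ≤
      p ^ 2 * (p - 2) * x ^ (p - 3) - 2 * p * ((1 - x ^ (p - 2)) / (1 - x)) + (p - 2) := by
    intro x hx hx1
    set q : ℝ := -p / x with hq
    have hqx : q * x = -p := div_mul_cancel₀ _ hx.ne'
    have hlim := nonneg_of_continuousAt_of_forall_pos hx (F := fun r =>
      (q + 1) ^ 2 * (p * r ^ (p - 1)) - 2 * (q + 1) * q * ((x ^ p - r ^ p) / (x - r)) -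
        2 * (q + 1) * ((1 - r ^ p) / (1 - r)) + q ^ 2 * (p * x ^ (p - 1)) +
        2 * q * ((1 - x ^ p) / (1 - x)) + p) ?_ ?_
    · have e1 : x ^ (p - 1) = x ^ (p - 3) * x ^ 2 := by
        rw [← Real.rpow_add_natCast hx.ne']; congr 1; push_cast; ring
      have e2 : x ^ (p - 2) = x ^ (p - 3) * x := by
        rw [← Real.rpow_add_one hx.ne']; congr 1; ring
      have e3 : x ^ p = x ^ (p - 3) * x ^ 3 := by
        rw [← Real.rpow_add_natCast hx.ne']; congr 1; push_cast; ring
      have hx1' : 1 - x ≠ 0 := by linarith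
      simp only [Real.zero_rpow (show p - 1 ≠ 0 by linarith),
        Real.zero_rpow (show p ≠ 0 by linarith), sub_zero, div_one, mul_zero, zero_sub] at hlim
      rw [e1, e3] at hlim
      rw [e2]
      convert hlim using 1
      rw [hq]
      field_simp
      ring
    · have c1 : ContinuousAt (fun r : ℝ => r ^ (p - 1)) 0 :=
        continuousAt_id.rpow_const (Or.inr (by linarith))
      have c2 : ContinuousAt (fun r : ℝ => r ^ p) 0 :=
        continuousAt_id.rpow_const (Or.inr (by linarith))
      have c3 : ContinuousAt (fun r : ℝ => (x ^ p - r ^ p) / (x - r)) 0 :=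
        ContinuousAt.div (by fun_prop) (by fun_prop) (by simpa using hx.ne')
      have c4 : ContinuousAt (fun r : ℝ => (1 - r ^ p) / (1 - r)) 0 :=
        ContinuousAt.div (by fun_prop) (by fun_prop) (by simp)
      fun_prop
    · intro r hr hrx
      rw [← loewnerForm_three_rpow p hrx.ne (hrx.trans hx1).ne hx1.ne]
      exact h _ _ (by intro i; fin_cases i <;> simp [hr, hx]) (sum_three_eq_zero q)
  have h2 := nonneg_of_continuousAt_of_forall_pos one_pos ?_ h1
  · simp only [Real.zero_rpow (show p - 3 ≠ 0 by linarith),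
      Real.zero_rpow (show p - 2 ≠ 0 by linarith)] at h2
    linarith
  · have c1 : ContinuousAt (fun r : ℝ => r ^ (p - 3)) 0 :=
      continuousAt_id.rpow_const (Or.inr (by linarith))
    have c2 : ContinuousAt (fun r : ℝ => r ^ (p - 2)) 0 :=
      continuousAt_id.rpow_const (Or.inr (by linarith))
    have c4 : ContinuousAt (fun r : ℝ => (1 - r ^ (p - 2)) / (1 - r)) 0 :=
      ContinuousAt.div (by fun_prop) (by fun_prop) (by simp)
    fun_prop

/-- The form at the points `r⁻¹, ε⁻¹, 1` and the vector `(-(q + 1), q, 1)` with `q = p ε⁻¹` is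
evaluated in the limit `r → 0` and then `ε → 0`. For `p < -1` it tends to `-p > 0`. -/
theorem neg_one_le_of_loewnerForm_nonpos {p : ℝ}
    (h : ∀ t v : Fin 3 → ℝ, (∀ i, 0 < t i) → ∑ i, v i = 0 →
      loewnerForm (fun s : ℝ => s ^ p) t v ≤ 0) : -1 ≤ p := by
  by_contra hp
  rw [not_le] at hp
  have h1 : ∀ ε : ℝ, 0 < ε → ε < 1 → 0 ≤
      -(p ^ 2 * p * ε ^ (-p - 1) + 2 * p * ((1 - ε ^ (-p)) / (ε - 1)) + p) := by
    intro ε hε hε1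
    set x : ℝ := ε⁻¹ with hx
    have hx1 : 1 < x := (one_lt_inv₀ hε).2 hε1
    have hx0 : 0 < x := by linarith
    set q : ℝ := p * x with hq
    have hlim := nonneg_of_continuousAt_of_forall_pos hε (F := fun r =>
      -((q + 1) ^ 2 * (p * r ^ (1 - p)) - 2 * (q + 1) * q * (r * (x ^ p - r ^ (-p)) / (r * x - 1)) -
        2 * (q + 1) * (r * (1 - r ^ (-p)) / (r - 1)) + q ^ 2 * (p * x ^ (p - 1)) +
        2 * q * ((1 - x ^ p) / (1 - x)) + p)) ?_ ?_
    · have e1 : x ^ (p - 1) = ε ^ (-p - 1) * ε ^ 2 := by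
        rw [← Real.rpow_add_natCast hε.ne', hx, Real.inv_rpow hε.le, ← Real.rpow_neg hε.le]
        congr 1; push_cast; ring
      have e3 : x ^ p = ε ^ (-p - 1) * ε := by
        rw [← Real.rpow_add_one hε.ne', hx, Real.inv_rpow hε.le, ← Real.rpow_neg hε.le]
        congr 1; ring
      have e2 : ε ^ (-p) = ε ^ (-p - 1) * ε := by
        rw [← Real.rpow_add_one hε.ne']; congr 1; ring
      simp only [Real.zero_rpow (show 1 - p ≠ 0 by linarith), mul_zero, zero_mul, zero_div,
        zero_sub, sub_zero, zero_add] at hlim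
      rw [e1, e3] at hlim
      rw [e2]
      convert hlim using 1
      have hne : ε - 1 ≠ 0 := by linarith
      have hne' : 1 - x ≠ 0 := by linarith
      have e4 : (1 - ε ^ (-p - 1) * ε) / (ε - 1) = x * ((1 - ε ^ (-p - 1) * ε) / (1 - x)) := by
        rw [← mul_div_assoc, div_eq_div_iff hne hne', hx]
        field_simp
      have e5 : x * ε = 1 := inv_mul_cancel₀ hε.ne'
      rw [e4, hq]
      linear_combination p ^ 3 * ε ^ (-p - 1) * (x * ε + 1) * e5
    · have c1 : ContinuousAt (fun r : ℝ => r ^ (1 - p)) 0 :=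
        continuousAt_id.rpow_const (Or.inr (by linarith))
      have c2 : ContinuousAt (fun r : ℝ => r ^ (-p)) 0 :=
        continuousAt_id.rpow_const (Or.inr (by linarith))
      have c3 : ContinuousAt (fun r : ℝ => r * (x ^ p - r ^ (-p)) / (r * x - 1)) 0 :=
        ContinuousAt.div (by fun_prop) (by fun_prop) (by simp)
      have c4 : ContinuousAt (fun r : ℝ => r * (1 - r ^ (-p)) / (r - 1)) 0 :=
        ContinuousAt.div (by fun_prop) (by fun_prop) (by simp)
      fun_prop
    · intro r hr hrε
      have hxr : x < r⁻¹ := (inv_lt_inv₀ hε hr).2 hrε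
      have hform := loewnerForm_three_rpow p (r := r⁻¹) (x := x) hxr.ne' (hx1.trans hxr).ne'
        hx1.ne' q
      have hle := h ![r⁻¹, x, 1] ![-(q + 1), q, 1]
        (by intro i; fin_cases i <;> simp [hr, hx0]) (sum_three_eq_zero q)
      rw [hform] at hle
      have f1 : (r⁻¹) ^ p = r ^ (-p) := by rw [Real.inv_rpow hr.le, ← Real.rpow_neg hr.le]
      have f2 : (r⁻¹) ^ (p - 1) = r ^ (1 - p) := by
        rw [Real.inv_rpow hr.le, ← Real.rpow_neg hr.le]; congr 1; ring
      have f3 : (x ^ p - r ^ (-p)) / (x - r⁻¹) = r * (x ^ p - r ^ (-p)) / (r * x - 1) := by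
        rw [show r * x - 1 = r * (x - r⁻¹) by field_simp, mul_div_mul_left _ _ hr.ne']
      have f4 : (1 - r ^ (-p)) / (1 - r⁻¹) = r * (1 - r ^ (-p)) / (r - 1) := by
        rw [show r - 1 = r * (1 - r⁻¹) by field_simp, mul_div_mul_left _ _ hr.ne']
      rw [f1, f2, f3, f4] at hle
      linarith
  have h2 := nonneg_of_continuousAt_of_forall_pos one_pos ?_ h1
  · simp only [Real.zero_rpow (show -p - 1 ≠ 0 by linarith),
      Real.zero_rpow (show -p ≠ 0 by linarith)] at h2
    linarith
  · have c1 : ContinuousAt (fun r : ℝ => r ^ (-p - 1)) 0 :=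
      continuousAt_id.rpow_const (Or.inr (by linarith))
    have c2 : ContinuousAt (fun r : ℝ => r ^ (-p)) 0 :=
      continuousAt_id.rpow_const (Or.inr (by linarith))
    have c4 : ContinuousAt (fun r : ℝ => (1 - r ^ (-p)) / (r - 1)) 0 :=
      ContinuousAt.div (by fun_prop) (by fun_prop) (by simp)
    fun_prop

end Necessity

/-! ### The exponent ranges for conditional definiteness -/

section Characterization

open Set

theorem isCPD_of_mem {p : ℝ} (hp : (0 ≤ p ∧ p ≤ 1) ∨ (2 ≤ p ∧ p ≤ 3)) {n : ℕ} {t : Fin n → ℝ}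
    (ht : ∀ i, 0 < t i) : IsCPD (loewnerMatrix (fun s : ℝ => s ^ p) t) := by
  rw [isCPD_loewnerMatrix_iff]
  intro v hv
  rcases hp with hp | hp
  · simpa using loewnerForm_rpow_sign (m := 1) (by norm_num) (a := p) (by simpa using hp) ht hv
  · have := loewnerForm_rpow_sign (m := 3) (by norm_num) (a := p)
      ⟨by norm_num; exact hp.1, by exact_mod_cast hp.2⟩ ht hv
    norm_num at this
    exact this

theorem isCND_of_mem {p : ℝ} (hp : (-1 ≤ p ∧ p ≤ 0) ∨ (1 ≤ p ∧ p ≤ 2)) {n : ℕ} {t : Fin n → ℝ}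
    (ht : ∀ i, 0 < t i) : IsCND (loewnerMatrix (fun s : ℝ => s ^ p) t) := by
  rw [isCND_loewnerMatrix_iff]
  intro v hv
  rcases hp with hp | hp
  · simpa using loewnerForm_rpow_sign (m := 0) (by norm_num) (a := p) (by simpa using hp) ht hv
  · have := loewnerForm_rpow_sign (m := 2) (by norm_num) (a := p)
      ⟨by norm_num; exact hp.1, by exact_mod_cast hp.2⟩ ht hv
    norm_num at this
    exact this

theorem isCPD_two_of_mem {p : ℝ} (hp : (0 ≤ p ∧ p ≤ 1) ∨ 2 ≤ p) {t : Fin 2 → ℝ}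
    (ht : ∀ i, 0 < t i) : IsCPD (loewnerMatrix (fun s : ℝ => s ^ p) t) := by
  rcases hp with hp | hp
  · exact isCPD_of_mem (Or.inl hp) ht
  · exact (isCPD_loewnerMatrix_iff _ _).2 fun v hv => loewnerForm_two_nonneg hp ht hv

theorem isCND_two_of_mem {p : ℝ} (hp : p ≤ 0 ∨ (1 ≤ p ∧ p ≤ 2)) {t : Fin 2 → ℝ}
    (ht : ∀ i, 0 < t i) : IsCND (loewnerMatrix (fun s : ℝ => s ^ p) t) := by
  rcases hp with hp | hp
  · exact (isCND_loewnerMatrix_iff _ _).2 fun v hv => loewnerForm_two_nonpos hp ht hv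
  · exact isCND_of_mem (Or.inr hp) ht

/-- Both signs at once are possible only for exponents `0`, `1`, `2`; away from these, a sufficient
condition for one sign excludes the other. -/
theorem exponent_of_isCPD_of_isCND {p : ℝ}
    (h₁ : ∀ t : Fin 2 → ℝ, (∀ i, 0 < t i) → IsCPD (loewnerMatrix (fun s : ℝ => s ^ p) t))
    (h₂ : ∀ t : Fin 2 → ℝ, (∀ i, 0 < t i) → IsCND (loewnerMatrix (fun s : ℝ => s ^ p) t)) :
    p = 0 ∨ p = 1 ∨ p = 2 :=
  exponent_of_loewnerForm_two_eq_zero fun t ht =>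
    le_antisymm ((isCND_loewnerMatrix_iff _ _).1 (h₂ t ht) _ (by simp))
      ((isCPD_loewnerMatrix_iff _ _).1 (h₁ t ht) _ (by simp))

theorem isCPD_two_iff (p : ℝ) :
    (∀ t : Fin 2 → ℝ, (∀ i, 0 < t i) → IsCPD (loewnerMatrix (fun s : ℝ => s ^ p) t)) ↔
      (0 ≤ p ∧ p ≤ 1) ∨ 2 ≤ p := by
  refine ⟨fun h => ?_, fun hp t ht => isCPD_two_of_mem hp ht⟩
  by_contra hp
  have hp' : p ≤ 0 ∨ (1 ≤ p ∧ p ≤ 2) := by grind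
  rcases exponent_of_isCPD_of_isCND h fun t ht => isCND_two_of_mem hp' ht with rfl | rfl | rfl <;>
    norm_num at hp

theorem isCND_two_iff (p : ℝ) :
    (∀ t : Fin 2 → ℝ, (∀ i, 0 < t i) → IsCND (loewnerMatrix (fun s : ℝ => s ^ p) t)) ↔
      p ≤ 0 ∨ (1 ≤ p ∧ p ≤ 2) := by
  refine ⟨fun h => ?_, fun hp t ht => isCND_two_of_mem hp ht⟩
  by_contra hp
  have hp' : (0 ≤ p ∧ p ≤ 1) ∨ 2 ≤ p := by grind
  rcases exponent_of_isCPD_of_isCND (fun t ht => isCPD_two_of_mem hp' ht) h with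
    rfl | rfl | rfl <;> norm_num at hp

theorem isCPD_three_iff (p : ℝ) :
    (∀ t : Fin 3 → ℝ, (∀ i, 0 < t i) → IsCPD (loewnerMatrix (fun s : ℝ => s ^ p) t)) ↔
      (0 ≤ p ∧ p ≤ 1) ∨ (2 ≤ p ∧ p ≤ 3) := by
  refine ⟨fun h => ?_, fun hp t ht => isCPD_of_mem hp ht⟩
  simp only [isCPD_loewnerMatrix_iff] at h
  have h2 : (0 ≤ p ∧ p ≤ 1) ∨ 2 ≤ p := by
    refine (isCPD_two_iff p).1 fun t ht => (isCPD_loewnerMatrix_iff _ _).2 fun v hv => ?_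
    rw [← loewnerForm_three_duplicate]
    exact h _ (by intro i; fin_cases i <;> simp [ht]) _
      (by simpa [Fin.sum_univ_three, Fin.sum_univ_two] using hv)
  have h3 := le_three_of_loewnerForm_nonneg fun t v ht hv => h t ht v hv
  exact h2.imp_right fun h2 => ⟨h2, h3⟩

theorem isCND_three_iff (p : ℝ) :
    (∀ t : Fin 3 → ℝ, (∀ i, 0 < t i) → IsCND (loewnerMatrix (fun s : ℝ => s ^ p) t)) ↔
      (-1 ≤ p ∧ p ≤ 0) ∨ (1 ≤ p ∧ p ≤ 2) := by
  refine ⟨fun h => ?_, fun hp t ht => isCND_of_mem hp ht⟩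
  simp only [isCND_loewnerMatrix_iff] at h
  have h2 : p ≤ 0 ∨ (1 ≤ p ∧ p ≤ 2) := by
    refine (isCND_two_iff p).1 fun t ht => (isCND_loewnerMatrix_iff _ _).2 fun v hv => ?_
    rw [← loewnerForm_three_duplicate]
    exact h _ (by intro i; fin_cases i <;> simp [ht]) _
      (by simpa [Fin.sum_univ_three, Fin.sum_univ_two] using hv)
  have h3 := neg_one_le_of_loewnerForm_nonpos fun t v ht hv => h t ht v hv
  exact h2.imp_left fun h2 => ⟨h3, h2⟩

theorem mem_of_matrixConvex_rpow {p : ℝ}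
    (h : MatrixConvex 2 (Ioi 0) (fun t : ℝ => t ^ p)) :
    (-1 ≤ p ∧ p ≤ 0) ∨ (1 ≤ p ∧ p ≤ 2) := by
  rcases le_or_gt p 0 with hp | hp
  · exact Or.inl ⟨neg_one_le_of_matrixConvex_rpow h, hp⟩
  · exact Or.inr ⟨one_le_of_matrixConvex_rpow_of_pos h hp, le_two_of_matrixConvex_rpow h⟩

end Characterization

end LoewnerPower

theorem proposition3p1
    (H : Type*) [NormedAddCommGroup H] [InnerProductSpace ℂ H] [CompleteSpace H]
    [TopologicalSpace.SeparableSpace H] (hH : ¬ FiniteDimensional ℂ H) (α : ℝ) :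
    -- (1)
    ((LoewnerPower.MatrixMonotone 2 (Set.Ioi 0) (fun t : ℝ => t ^ α) ↔ 0 ≤ α ∧ α ≤ 1) ∧
      (LoewnerPower.MatrixMonotone 2 (Set.Ioi 0) (fun t : ℝ => t ^ α) ↔
        LoewnerPower.OperatorMonotone H (Set.Ioi 0) (fun t : ℝ => t ^ α)) ∧
      (LoewnerPower.MatrixMonotone 2 (Set.Ioi 0) (fun t : ℝ => -(t ^ α)) ↔ -1 ≤ α ∧ α ≤ 0)) ∧
    -- (2)
    ((LoewnerPower.MatrixConvex 2 (Set.Ioi 0) (fun t : ℝ => t ^ α) ↔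
        (-1 ≤ α ∧ α ≤ 0) ∨ (1 ≤ α ∧ α ≤ 2)) ∧
      (LoewnerPower.MatrixConvex 2 (Set.Ioi 0) (fun t : ℝ => t ^ α) ↔
        LoewnerPower.OperatorConvex H (Set.Ioi 0) (fun t : ℝ => t ^ α))) ∧
    -- (3)
    ((∀ t : Fin 2 → ℝ, (∀ i, 0 < t i) →
        LoewnerPower.IsCPD (LoewnerPower.loewnerMatrix (fun s : ℝ => s ^ α) t)) ↔
      (0 ≤ α ∧ α ≤ 1) ∨ 2 ≤ α) ∧
    -- (4)
    ((∀ t : Fin 2 → ℝ, (∀ i, 0 < t i) →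
        LoewnerPower.IsCND (LoewnerPower.loewnerMatrix (fun s : ℝ => s ^ α) t)) ↔
      α ≤ 0 ∨ (1 ≤ α ∧ α ≤ 2)) ∧
    -- (5)
    ((∀ t : Fin 3 → ℝ, (∀ i, 0 < t i) →
        LoewnerPower.IsCPD (LoewnerPower.loewnerMatrix (fun s : ℝ => s ^ α) t)) ↔
      (0 ≤ α ∧ α ≤ 1) ∨ (2 ≤ α ∧ α ≤ 3)) ∧
    -- (6)
    ((∀ t : Fin 3 → ℝ, (∀ i, 0 < t i) →
        LoewnerPower.IsCND (LoewnerPower.loewnerMatrix (fun s : ℝ => s ^ α) t)) ↔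
      (-1 ≤ α ∧ α ≤ 0) ∨ (1 ≤ α ∧ α ≤ 2)) := by
  have mono_of_op : LoewnerPower.OperatorMonotone H (Set.Ioi 0) (fun t : ℝ => t ^ α) →
      LoewnerPower.MatrixMonotone 2 (Set.Ioi 0) (fun t : ℝ => t ^ α) :=
    fun h => h.matrixMonotone hH (Set.mem_Ioi.2 one_pos)
  have mem_of_mono : LoewnerPower.MatrixMonotone 2 (Set.Ioi 0) (fun t : ℝ => t ^ α) →
      0 ≤ α ∧ α ≤ 1 := fun h =>
    ⟨LoewnerPower.nonneg_of_matrixMonotone_rpow h, LoewnerPower.le_one_of_matrixMonotone_rpow h⟩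
  have conv_of_op : LoewnerPower.OperatorConvex H (Set.Ioi 0) (fun t : ℝ => t ^ α) →
      LoewnerPower.MatrixConvex 2 (Set.Ioi 0) (fun t : ℝ => t ^ α) :=
    fun h => h.matrixConvex hH (Set.mem_Ioi.2 one_pos)
  refine ⟨⟨⟨mem_of_mono, fun h => mono_of_op (LoewnerPower.operatorMonotone_rpow h)⟩,
    ⟨fun h => LoewnerPower.operatorMonotone_rpow (mem_of_mono h), mono_of_op⟩,
    fun h => ⟨LoewnerPower.neg_one_le_of_matrixMonotone_neg_rpow h,
      LoewnerPower.nonpos_of_matrixMonotone_neg_rpow h⟩,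
    fun h => (LoewnerPower.operatorMonotone_neg_rpow (H := H) h).matrixMonotone hH
      (Set.mem_Ioi.2 one_pos)⟩,
    ⟨⟨LoewnerPower.mem_of_matrixConvex_rpow, fun h =>
      conv_of_op (LoewnerPower.operatorConvex_rpow h)⟩,
    ⟨fun h => LoewnerPower.operatorConvex_rpow (LoewnerPower.mem_of_matrixConvex_rpow h),
      conv_of_op⟩⟩,
    LoewnerPower.isCPD_two_iff α, LoewnerPower.isCND_two_iff α, LoewnerPower.isCPD_three_iff α,
    LoewnerPower.isCND_three_iff α⟩
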